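/- Let $\mu$ be the Möbius function and $\zeta$ the Riemann zeta function. For a positive integer $N$ let $\mathbf m=(\mu(1),\dots,\mu(N))^{\rm T}$, let $\|\mathbf m\|$ be its Euclidean norm, let $A$ be the $N\times N$ matrix with entries $a_{mn}=\lfloor N^2/(mn)\rfloor$ $(1\le m,n\le N)$, put $\zeta_1=\sum_{m\le N}1/m$, and for $s\in\mathbb C$ put $M(s,N)=\sum_{n\le N}\mu(n)n^{-s}$. There is an absolute constant $C>0$ such that for every positive integer $N$ and every real $T_0$ with $3\le T_0\le N$ there exists $T\in[T_0,2T_0]$ with $$\left|\frac{\mathbf m^{\rm T}A\,\mathbf m}{N^2}-\bigl(M(1,N)\bigr)^2-\frac{\|\mathbf m\|^2}{N}\int_{-T}^{T}\frac{\zeta_1N^{2it}\,\zeta(\frac12+it)}{\pi+2\pi it}\left(\frac{M(\frac12+it,N)}{\sqrt{\zeta_1}\,\|\mathbf m\|}\right)^2dt\right|\le C\,\frac{\log^3N}{T_0}.$$ -/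

import Mathlib

noncomputable section

namespace MertensForm

/-- The column vector `(μ(1), …, μ(N))ᵀ`; the index `i : Fin N` stands for the integer `i + 1`. -/
def moebiusVec (N : ℕ) : Fin N → ℝ :=
  fun i => (ArithmeticFunction.moebius ((i : ℕ) + 1) : ℝ)

/-- The `N × N` matrix with entries `⌊N² / (m n)⌋` for `m, n ∈ {1, …, N}`. -/
def floorMatrix (N : ℕ) : Matrix (Fin N) (Fin N) ℝ :=
  Matrix.of fun i j =>
    ((⌊(N : ℝ) ^ 2 / ((((i : ℕ) + 1 : ℕ) : ℝ) * (((j : ℕ) + 1 : ℕ) : ℝ))⌋ : ℤ) : ℝ)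

/-- The quadratic form `mᵀ A m`, for `m = (μ(1), …, μ(N))ᵀ` and the matrix `A = A(N)`. -/
def quadForm (N : ℕ) : ℝ :=
  moebiusVec N ⬝ᵥ (floorMatrix N).mulVec (moebiusVec N)

/-- The Euclidean norm of the vector `(μ(1), …, μ(N))ᵀ`. -/
def moebiusNorm (N : ℕ) : ℝ :=
  ‖(WithLp.toLp 2 (moebiusVec N) : EuclideanSpace ℝ (Fin N))‖

/-- The sum `M(s, x) = ∑_{n ≤ x} μ(n) n^{-s}`, for complex `s`. -/
def mertensSum (s : ℂ) (x : ℝ) : ℂ :=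
  ∑ n ∈ Finset.Icc 1 ⌊x⌋₊, (ArithmeticFunction.moebius n : ℂ) * (n : ℂ) ^ (-s)

/-- The truncated zeta sum `ζ_j = ∑_{m ≤ N} m^{-j}`. -/
def truncZeta (N j : ℕ) : ℝ :=
  ∑ m ∈ Finset.Icc 1 N, ((m : ℝ) ^ j)⁻¹

/-- The integrand
`ζ₁ N^{2it} ζ(1/2 + it) / (π + 2πit) · (M(1/2 + it, N) / (√ζ₁ ‖m‖))²`. -/
def integrand (N : ℕ) (t : ℝ) : ℂ :=
  (truncZeta N 1 : ℂ) * (N : ℂ) ^ (2 * Complex.I * (t : ℂ))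
      * riemannZeta (1 / 2 + Complex.I * (t : ℂ))
    / ((Real.pi : ℂ) + 2 * (Real.pi : ℂ) * Complex.I * (t : ℂ))
    * (mertensSum (1 / 2 + Complex.I * (t : ℂ)) (N : ℝ)
        / ((Real.sqrt (truncZeta N 1) : ℂ) * (moebiusNorm N : ℂ))) ^ 2

end MertensForm

end

open MeasureTheory Set Filter Topology

namespace MertensForm

/-! Since `⌊N²/(mn)⌋` counts the multiples of `mn` up to `N²`, the quadratic form is the partial sum
up to `N²` of the coefficients `a_k` (`mertensCoeff`) of the Dirichlet series `ζ(s) M(s,N)²`.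
Perron's formula on `Re s = 1 + 1/log N` turns it into an integral of `N^{2s} ζ(s) M(s,N)² / s`.
Moving the line to `Re s = 1/2` crosses only the pole of `ζ` at `1`, with residue `N² M(1,N)²`. The
integral on the new line is, after division by `N²`, the one in the theorem, because `ζ₁` and `‖m‖`
cancel there. Two errors have to be `O(N² log³ N / T)`.

Perron error (`norm_quadForm_sub_integral_le`). Far from `N²` the bound `|a_k| ≤ d₃(k)` and `ζ(c)³ ≪
log³ N` suffice. Near `N²` the identity `∑_{d ∣ j} μ(d) = 0` for `j ≠ 1` shows that `a_k` is
controlled by factorizations `k = m d` with `m > N`, hence `d ≤ 2N`. For each `d` the values `k` lie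
in a progression whose step is small enough, as `T ≤ 2N`, for the Perron kernel to average well
(`sum_abs_mertensCoeff_near_le`).

Horizontal sides (`norm_integral_perronFun_sub_le`). There `N^σ |M(s,N)| ≪ N log N` uniformly in
`1/2 ≤ σ ≤ 1 + 1/log N`, so what remains is `∫ |ζ(x + iT)| dx`. The mean square of `ζ` on vertical
lines is `O(T log T)`, so some `T ∈ [T₀, 2T₀]` makes this integral `O(log T₀)`. This is the only
place where `T` has to be chosen. The mean square comes from an Euler–Maclaurin formula for `ζ` and
a Gaussian-weighted mean value theorem proved by a Schur test. -/

/-! ### Euler–Maclaurin formula for `ζ` in `Re s > 0` -/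

/-- The Laplace transform of the fractional part of `e^p` over `p > a`. -/
noncomputable def fractTail (a : ℝ) (s : ℂ) : ℂ :=
  ∫ p in Ioi a, ((Int.fract (Real.exp p) : ℝ) : ℂ) * Complex.exp (-s * p)

lemma norm_fract_mul_exp_le (s : ℂ) (p : ℝ) :
    ‖((Int.fract (Real.exp p) : ℝ) : ℂ) * Complex.exp (-s * p)‖ ≤ Real.exp (-s.re * p) := by
  rw [norm_mul, Complex.norm_exp, Complex.norm_real, Real.norm_of_nonneg (Int.fract_nonneg _)]
  simpa using mul_le_of_le_one_left (Real.exp_pos (-(s.re * p))).le (Int.fract_lt_one (Real.exp p)).le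

lemma measurable_fract_mul_exp (s : ℂ) :
    Measurable fun p : ℝ => ((Int.fract (Real.exp p) : ℝ) : ℂ) * Complex.exp (-s * p) := by
  fun_prop

lemma integrableOn_fract_mul_exp (a : ℝ) {s : ℂ} (hs : 0 < s.re) :
    IntegrableOn (fun p : ℝ => ((Int.fract (Real.exp p) : ℝ) : ℂ) * Complex.exp (-s * p)) (Ioi a) := by
  refine Integrable.mono' (exp_neg_integrableOn_Ioi a hs)
    (measurable_fract_mul_exp s).aestronglyMeasurable (ae_of_all _ fun p => ?_)
  exact norm_fract_mul_exp_le s p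

lemma norm_fractTail_le (a : ℝ) {s : ℂ} (hs : 0 < s.re) :
    ‖fractTail a s‖ ≤ Real.exp (-s.re * a) / s.re := by
  refine (norm_integral_le_of_norm_le (exp_neg_integrableOn_Ioi a hs)
    (ae_of_all _ fun p => norm_fract_mul_exp_le s p)).trans_eq ?_
  rw [integral_exp_mul_Ioi (by linarith)]
  field_simp

lemma differentiableAt_fractTail {a : ℝ} (ha : 0 ≤ a) {s : ℂ} (hs : 0 < s.re) :
    DifferentiableAt ℂ (fractTail a) s := by
  have hb : 0 < s.re / 4 := by linarith
  have hnhds : {z : ℂ | s.re / 2 < z.re} ∈ 𝓝 s :=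
    (isOpen_lt continuous_const Complex.continuous_re).mem_nhds (by simp; linarith)
  refine (hasDerivAt_integral_of_dominated_loc_of_deriv_le (μ := volume.restrict (Ioi a))
    (F := fun z (p : ℝ) => ((Int.fract (Real.exp p) : ℝ) : ℂ) * Complex.exp (-z * p))
    (F' := fun z (p : ℝ) => ((Int.fract (Real.exp p) : ℝ) : ℂ) * (Complex.exp (-z * p) * (-1 * p)))
    (bound := fun p => (s.re / 4)⁻¹ * Real.exp (-(s.re / 4) * p)) hnhds
    (Eventually.of_forall fun z => (measurable_fract_mul_exp z).aestronglyMeasurable)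
    (integrableOn_fract_mul_exp a hs) ?_ ?_ ?_ ?_).2.differentiableAt
  · exact Measurable.aestronglyMeasurable (by fun_prop)
  · refine (ae_restrict_iff' measurableSet_Ioi).2 (ae_of_all _ fun p hp z hz => ?_)
    have hp0 : 0 ≤ p := ha.trans (le_of_lt hp)
    have hz' : s.re / 2 < z.re := hz
    have h1 := norm_fract_mul_exp_le z p
    rw [← mul_assoc, norm_mul]
    have h2 : ‖(-1 * p : ℂ)‖ = p := by simp [abs_of_nonneg hp0]
    rw [h2]
    -- The factor `p` produced by differentiation costs a quarter of the decay rate. The half-plane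
    -- `Re z > Re s / 2` supplies half of it, so a quarter is left for integrability.
    have h3 : p ≤ (s.re / 4)⁻¹ * Real.exp (s.re / 4 * p) := by
      rw [← div_eq_inv_mul, le_div_iff₀ hb]
      linarith [Real.add_one_le_exp (s.re / 4 * p)]
    have h4 : Real.exp (-z.re * p) ≤ Real.exp (-(s.re / 2) * p) :=
      Real.exp_le_exp.2 (by nlinarith)
    calc _ ≤ Real.exp (-(s.re / 2) * p) * ((s.re / 4)⁻¹ * Real.exp (s.re / 4 * p)) :=
          mul_le_mul (h1.trans h4) h3 hp0 (Real.exp_pos _).le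
      _ = (s.re / 4)⁻¹ * (Real.exp (-(s.re / 2) * p) * Real.exp (s.re / 4 * p)) := by ring
      _ = _ := by rw [← Real.exp_add]; ring_nf
  · exact (exp_neg_integrableOn_Ioi a hb).const_mul _
  · refine ae_of_all _ fun p z _ => ?_
    have := (((hasDerivAt_id z).neg.mul_const (p : ℂ)).cexp).const_mul
      ((Int.fract (Real.exp p) : ℝ) : ℂ)
    simpa using this

/-- Euler–Maclaurin partial sum for the zeta function. -/
noncomputable def zetaApprox (X : ℕ) (s : ℂ) : ℂ :=
  ∑ n ∈ Finset.Icc 1 X, (n : ℂ) ^ (-s) + (X : ℂ) ^ (1 - s) / (s - 1)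
    - s * fractTail (Real.log X) s

lemma integral_fract_mul_exp_log {X : ℕ} (hX : 1 ≤ X) {s : ℂ} (hs : s ≠ 0) (hs1 : s ≠ 1) :
    ∫ p in Ioc (Real.log X) (Real.log (X + 1 : ℕ)),
        ((Int.fract (Real.exp p) : ℝ) : ℂ) * Complex.exp (-s * p)
      = (((X + 1 : ℕ) : ℂ) ^ (1 - s) - (X : ℂ) ^ (1 - s)) / (1 - s)
        + X * (((X + 1 : ℕ) : ℂ) ^ (-s) - (X : ℂ) ^ (-s)) / s := by
  have hX0 : (0 : ℝ) < X := by exact_mod_cast hX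
  have hX1 : (0 : ℝ) < (X + 1 : ℕ) := by positivity
  have hle : Real.log X ≤ Real.log (X + 1 : ℕ) := Real.log_le_log hX0 (by push_cast; linarith)
  have hs1' : 1 - s ≠ 0 := sub_ne_zero.2 hs1.symm
  -- At the right endpoint the fractional part drops to `0`, so `{e^p} = e^p - X` is only available
  -- on the open interval.
  rw [integral_Ioc_eq_integral_Ioo]
  have h1 : ∫ p in Ioo (Real.log X) (Real.log (X + 1 : ℕ)),
      ((Int.fract (Real.exp p) : ℝ) : ℂ) * Complex.exp (-s * p)
      = ∫ p in Ioo (Real.log X) (Real.log (X + 1 : ℕ)),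
        (Complex.exp ((1 - s) * p) - X * Complex.exp (-s * p)) := by
    refine setIntegral_congr_fun measurableSet_Ioo fun p hp => ?_
    have hl : (X : ℝ) < Real.exp p := (Real.log_lt_iff_lt_exp hX0).1 hp.1
    have hu : Real.exp p < (X + 1 : ℕ) := (Real.lt_log_iff_exp_lt hX1).1 hp.2
    have hf : Int.fract (Real.exp p) = Real.exp p - X := by
      rw [Int.fract_eq_iff]
      refine ⟨by linarith, by push_cast at hu; linarith, X, by push_cast; ring⟩
    simp only [hf]
    push_cast
    rw [sub_mul, ← Complex.exp_add]
    ring_nf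
  have h2 : ∀ (r : ℂ), ∀ Y : ℕ, (0 : ℝ) < Y →
      Complex.exp (r * (Real.log Y : ℝ)) = (Y : ℂ) ^ r := by
    intro r Y hY
    rw [Complex.cpow_def_of_ne_zero (by exact_mod_cast hY.ne'), mul_comm, Complex.natCast_log]
  rw [h1, ← integral_Ioc_eq_integral_Ioo, ← intervalIntegral.integral_of_le hle,
    intervalIntegral.integral_eq_sub_of_hasDerivAt
      (f := fun p : ℝ => Complex.exp ((1 - s) * p) / (1 - s) + X * Complex.exp (-s * p) / s)]
  · simp only [h2 _ X hX0, h2 _ (X + 1) hX1]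
    ring
  · intro p _
    have e1 : HasDerivAt (fun p : ℝ => (p : ℂ)) 1 p := Complex.ofRealCLM.hasDerivAt
    have e2 := ((e1.const_mul (1 - s)).cexp.div_const (1 - s)).add
      (((e1.const_mul (-s)).cexp.const_mul (X : ℂ)).div_const s)
    refine e2.congr_deriv ?_
    field_simp
    ring
  · exact Continuous.intervalIntegrable (by fun_prop) _ _

/-- The new summand and the change of `X^{1-s}/(s-1)` are exactly compensated by the piece of the
tail integral between `log X` and `log (X+1)`. The freedom in `X` is used three times: `X = 1` for
continuation, `X → ∞` to recognise `ζ`, and `X ≈ T` in the mean square. -/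
lemma zetaApprox_succ {X : ℕ} (hX : 1 ≤ X) {s : ℂ} (hs : 0 < s.re) (hs1 : s ≠ 1) :
    zetaApprox (X + 1) s = zetaApprox X s := by
  have hs0 : s ≠ 0 := by rintro rfl; simp at hs
  have hX0 : (0 : ℝ) < X := by exact_mod_cast hX
  have hle : Real.log X ≤ Real.log (X + 1 : ℕ) := Real.log_le_log hX0 (by push_cast; linarith)
  have h1 : fractTail (Real.log X) s = (∫ p in Ioc (Real.log X) (Real.log (X + 1 : ℕ)),
        ((Int.fract (Real.exp p) : ℝ) : ℂ) * Complex.exp (-s * p)) + fractTail (Real.log (X + 1 : ℕ)) s := by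
    rw [fractTail, ← Ioc_union_Ioi_eq_Ioi hle, setIntegral_union
      (Ioc_disjoint_Ioi le_rfl) measurableSet_Ioi
      ((integrableOn_fract_mul_exp _ hs).mono_set Ioc_subset_Ioi_self)
      (integrableOn_fract_mul_exp _ hs), fractTail]
  rw [integral_fract_mul_exp_log hX hs0 hs1] at h1
  rw [zetaApprox, zetaApprox, h1, Finset.sum_Icc_succ_top (by omega)]
  have hs1' : 1 - s ≠ 0 := sub_ne_zero.2 hs1.symm
  have hs1'' : s - 1 ≠ 0 := sub_ne_zero.2 hs1
  have e1 : ((X + 1 : ℕ) : ℂ) ^ (1 - s) = (X + 1 : ℕ) * ((X + 1 : ℕ) : ℂ) ^ (-s) := by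
    rw [sub_eq_add_neg, Complex.cpow_add _ _ (by exact_mod_cast (Nat.succ_ne_zero X)), Complex.cpow_one]
  have e2 : (X : ℂ) ^ (1 - s) = X * (X : ℂ) ^ (-s) := by
    rw [sub_eq_add_neg, Complex.cpow_add _ _ (by exact_mod_cast hX0.ne'), Complex.cpow_one]
  rw [e1, e2]
  generalize ((X + 1 : ℕ) : ℂ) ^ (-s) = u
  generalize (X : ℂ) ^ (-s) = v
  have e3 : (1 - s) = -(s - 1) := by ring
  rw [e3]
  push_cast
  field_simp
  ring

lemma zetaApprox_eq_one {X : ℕ} (hX : 1 ≤ X) {s : ℂ} (hs : 0 < s.re) (hs1 : s ≠ 1) :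
    zetaApprox X s = zetaApprox 1 s := by
  induction X, hX using Nat.le_induction with
  | base => rfl
  | succ n hn ih => rw [zetaApprox_succ hn hs hs1, ih]

lemma zetaApprox_one (s : ℂ) :
    zetaApprox 1 s = 1 + 1 / (s - 1) - s * fractTail 0 s := by
  simp [zetaApprox]

/-- The value does not depend on `X`; as `X → ∞` both correction terms vanish and the partial sums
tend to `ζ(s)`. -/
lemma zetaApprox_one_of_one_lt_re {s : ℂ} (hs : 1 < s.re) :
    zetaApprox 1 s = riemannZeta s := by
  have hs1 : s ≠ 1 := by rintro rfl; simp at hs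
  have h0 : 0 < s.re := by linarith
  have hs0 : s ≠ 0 := by rintro rfl; simp at h0
  have h1 : Tendsto (fun X : ℕ => zetaApprox X s) atTop (𝓝 (zetaApprox 1 s)) := by
    refine tendsto_const_nhds.congr' ?_
    filter_upwards [eventually_ge_atTop 1] with X hX using (zetaApprox_eq_one hX h0 hs1).symm
  refine tendsto_nhds_unique h1 ?_
  have t1 : Tendsto (fun X : ℕ => ∑ n ∈ Finset.Icc 1 X, (n : ℂ) ^ (-s)) atTop
      (𝓝 (riemannZeta s)) := by
    rw [zeta_eq_tsum_one_div_nat_cpow hs]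
    have hsum := (Complex.summable_one_div_nat_cpow.2 hs).hasSum.tendsto_sum_nat
    refine ((tendsto_add_atTop_iff_nat 1).2 hsum).congr fun X => ?_
    rw [Finset.sum_range_succ', Nat.cast_zero, Complex.zero_cpow hs0, div_zero, add_zero,
      Finset.range_eq_Ico, Finset.sum_Ico_add' (fun n : ℕ => 1 / (n : ℂ) ^ s) 0 X 1]
    refine Finset.sum_congr (by ext; simp) fun n _ => ?_
    rw [Complex.cpow_neg, one_div]
  have hre : Tendsto (fun X : ℕ => (X : ℝ) ^ (-(s.re - 1))) atTop (𝓝 0) :=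
    (tendsto_rpow_neg_atTop (by linarith)).comp tendsto_natCast_atTop_atTop
  have t2 : Tendsto (fun X : ℕ => (X : ℂ) ^ (1 - s) / (s - 1)) atTop (𝓝 0) := by
    have : Tendsto (fun X : ℕ => (X : ℂ) ^ (1 - s)) atTop (𝓝 0) := by
      rw [tendsto_zero_iff_norm_tendsto_zero]
      refine hre.congr' ?_
      filter_upwards [eventually_gt_atTop 0] with X hX
      rw [Complex.norm_natCast_cpow_of_pos hX]
      simp
    simpa using this.div_const (s - 1)
  have t3 : Tendsto (fun X : ℕ => s * fractTail (Real.log X) s) atTop (𝓝 0) := by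
    have hlog : Tendsto (fun X : ℕ => Real.log X) atTop atTop :=
      Real.tendsto_log_atTop.comp tendsto_natCast_atTop_atTop
    have : Tendsto (fun X : ℕ => fractTail (Real.log X) s) atTop (𝓝 0) := by
      refine squeeze_zero_norm (fun X => norm_fractTail_le _ h0) ?_
      have : Tendsto (fun X : ℕ => Real.exp (-s.re * Real.log X)) atTop (𝓝 0) :=
        Real.tendsto_exp_atBot.comp (hlog.const_mul_atTop_of_neg (by linarith))
      simpa using this.div_const s.re
    simpa using this.const_mul s
  simpa [zetaApprox] using (t1.add t2).sub t3

/-- Identity principle on `Re s > 0`, applied after multiplication by `s - 1` so that both sides are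
holomorphic at `1`; they agree near `2`. -/
theorem riemannZeta_eq_zetaApprox {X : ℕ} (hX : 1 ≤ X) {s : ℂ} (hs : 0 < s.re) (hs1 : s ≠ 1) :
    riemannZeta s = zetaApprox X s := by
  rw [zetaApprox_eq_one hX hs hs1]
  set U : Set ℂ := {z | 0 < z.re} with hU
  have hUo : IsOpen U := isOpen_lt continuous_const Complex.continuous_re
  have hUc : IsPreconnected U := (convex_halfSpace_re_gt 0).isPreconnected
  have hd1 : AnalyticOnNhd ℂ riemannZeta₁ U :=
    differentiable_riemannZeta₁.differentiableOn.analyticOnNhd hUo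
  have hd2 : AnalyticOnNhd ℂ (fun z => z - z * (z - 1) * fractTail 0 z) U := by
    refine DifferentiableOn.analyticOnNhd (fun z hz => ?_) hUo
    have := differentiableAt_fractTail le_rfl hz
    exact DifferentiableAt.differentiableWithinAt (by fun_prop)
  have h2 : (2 : ℂ) ∈ U := by simp [hU]
  have hev : riemannZeta₁ =ᶠ[𝓝 2] fun z => z - z * (z - 1) * fractTail 0 z := by
    have : {z : ℂ | 1 < z.re} ∈ 𝓝 (2 : ℂ) :=
      (isOpen_lt continuous_const Complex.continuous_re).mem_nhds (by simp)
    filter_upwards [this] with z hz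
    have hz1 : z ≠ 1 := by rintro rfl; simp at hz
    have hz1' : z - 1 ≠ 0 := sub_ne_zero.2 hz1
    have := zetaApprox_one_of_one_lt_re hz
    rw [zetaApprox_one, riemannZeta_eq_inv_sub_mul hz1] at this
    field_simp at this
    linear_combination -this
  have := hd1.eqOn_of_preconnected_of_eventuallyEq hd2 hUc h2 hev hs
  have hz1' : s - 1 ≠ 0 := sub_ne_zero.2 hs1
  rw [riemannZeta_eq_inv_sub_mul hs1, this, zetaApprox_one]
  field_simp
  ring

/-! ### Mean values with a Gaussian weight -/

lemma integral_gaussian_mul_cexp {T : ℝ} (hT : 0 < T) (y : ℝ) :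
    ∫ t : ℝ, Complex.exp (-Complex.I * t * y) * ((Real.exp (-(t / T) ^ 2) : ℝ) : ℂ)
      = ((T * √Real.pi * Real.exp (-(T * y) ^ 2 / 4) : ℝ) : ℂ) := by
  have hb : 0 < (((1 / T ^ 2 : ℝ) : ℂ)).re := by rw [Complex.ofReal_re]; positivity
  have h := fourierIntegral_gaussian hb (-y : ℂ)
  have hT' : (T : ℂ) ≠ 0 := by exact_mod_cast hT.ne'
  have e1 : (fun t : ℝ => Complex.exp (-Complex.I * t * y) * ((Real.exp (-(t / T) ^ 2) : ℝ) : ℂ))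
      = fun x : ℝ => Complex.exp (Complex.I * (-y) * x) *
        Complex.exp (-((1 / T ^ 2 : ℝ) : ℂ) * x ^ 2) := by
    funext t
    push_cast
    rw [← Complex.exp_add, ← Complex.exp_add]
    congr 1
    field_simp
  rw [e1, h]
  have e2 : ((Real.pi : ℂ) / ((1 / T ^ 2 : ℝ) : ℂ)) = ((Real.pi * T ^ 2 : ℝ) : ℂ) := by
    push_cast; field_simp
  have e3 : ((1 : ℂ) / 2) = ((1 / 2 : ℝ) : ℂ) := by push_cast; rfl
  rw [e2, e3, ← Complex.ofReal_cpow (by positivity), ← Real.sqrt_eq_rpow,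
    Real.sqrt_mul Real.pi_pos.le, Real.sqrt_sq hT.le]
  push_cast
  have e4 : -(-(y : ℂ)) ^ 2 / (4 * (1 / T ^ 2)) = -(T * y) ^ 2 / 4 := by
    field_simp
  rw [e4]
  ring

lemma integrable_exp_neg_div_sq {T : ℝ} (hT : 0 < T) :
    Integrable fun t : ℝ => Real.exp (-(t / T) ^ 2) := by
  have := integrable_exp_neg_mul_sq (b := 1 / T ^ 2) (by positivity)
  refine this.congr (ae_of_all _ fun t => ?_)
  simp only
  congr 1
  field_simp

section MeanSquare

variable {α : Type*} [MeasurableSpace α] {ν : Measure α} {g : α → ℂ} {φ : α → ℝ}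
  {T B : ℝ}

lemma aestronglyMeasurable_mul_cexp (hφ : Measurable φ) (hg : Integrable g ν) :
    AEStronglyMeasurable (fun p : ℝ × α => g p.2 * Complex.exp (-Complex.I * p.1 * φ p.2))
      (volume.prod ν) := by
  refine hg.aestronglyMeasurable.comp_snd.mul (Measurable.aestronglyMeasurable ?_)
  fun_prop

variable [SFinite ν]

lemma norm_mul_cexp (z : ℂ) (t y : ℝ) : ‖z * Complex.exp (-Complex.I * t * y)‖ = ‖z‖ := by
  rw [norm_mul, Complex.norm_exp]
  simp

lemma integrable_gaussian_mean_square (hT : 0 < T) (hφ : Measurable φ) (hg : Integrable g ν) :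
    Integrable fun t : ℝ => ‖∫ u, g u * Complex.exp (-Complex.I * t * φ u) ∂ν‖ ^ 2
      * Real.exp (-(t / T) ^ 2) := by
  have hm : AEStronglyMeasurable
      (fun t : ℝ => ∫ u, g u * Complex.exp (-Complex.I * t * φ u) ∂ν) :=
    (aestronglyMeasurable_mul_cexp hφ hg).integral_prod_right'
  refine Integrable.mono' ((integrable_exp_neg_div_sq hT).const_mul ((∫ u, ‖g u‖ ∂ν) ^ 2))
    ((hm.norm.pow 2).mul (integrable_exp_neg_div_sq hT).aestronglyMeasurable)
    (ae_of_all _ fun t => ?_)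
  rw [norm_mul, norm_pow, norm_norm, Real.norm_of_nonneg (Real.exp_pos _).le]
  gcongr
  refine (norm_integral_le_integral_norm _).trans_eq ?_
  simp only [norm_mul_cexp]

/-- Expanding the square and applying Fubini leaves the Fourier transform of the Gaussian at `φ u -
φ v`. A general measure `ν` is kept so that the result covers both Dirichlet polynomials (counting
measure, `φ = log`) and `fractTail` (Lebesgue measure, `φ = id`). -/
lemma gaussian_mean_square_eq (hT : 0 < T) (hφ : Measurable φ) (hg : Integrable g ν) :
    ((∫ t : ℝ, ‖∫ u, g u * Complex.exp (-Complex.I * t * φ u) ∂ν‖ ^ 2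
      * Real.exp (-(t / T) ^ 2) : ℝ) : ℂ)
    = ∫ p : α × α, g p.1 * (starRingEnd ℂ) (g p.2) *
        ((T * √Real.pi * Real.exp (-(T * (φ p.1 - φ p.2)) ^ 2 / 4) : ℝ) : ℂ) ∂(ν.prod ν) := by
  have hgc : Integrable (fun u => (starRingEnd ℂ) (g u)) ν :=
    ⟨Complex.continuous_conj.comp_aestronglyMeasurable hg.1, by
      simpa [HasFiniteIntegral, enorm_eq_nnnorm] using hg.2⟩
  set F : ℝ → α × α → ℂ := fun t p => g p.1 * (starRingEnd ℂ) (g p.2) *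
    (Complex.exp (-Complex.I * t * (φ p.1 - φ p.2 : ℝ)) * ((Real.exp (-(t / T) ^ 2) : ℝ) : ℂ))
    with hF
  have hgg : Integrable (fun p : α × α => g p.1 * (starRingEnd ℂ) (g p.2)) (ν.prod ν) :=
    hg.mul_prod hgc
  have hFi : Integrable (Function.uncurry F) (volume.prod (ν.prod ν)) := by
    refine Integrable.mono' ((integrable_exp_neg_div_sq hT).mul_prod hgg.norm) ?_
      (ae_of_all _ fun q => ?_)
    · refine hgg.aestronglyMeasurable.comp_snd.mul (Measurable.aestronglyMeasurable ?_)
      fun_prop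
    · obtain ⟨t, p⟩ := q
      simp only [Function.uncurry, hF]
      rw [← mul_assoc, norm_mul, norm_mul_cexp, Complex.norm_real,
        Real.norm_of_nonneg (Real.exp_pos _).le, mul_comm]
  have h1 : ∀ t : ℝ, ((‖∫ u, g u * Complex.exp (-Complex.I * t * φ u) ∂ν‖ ^ 2
      * Real.exp (-(t / T) ^ 2) : ℝ) : ℂ) = ∫ p, F t p ∂(ν.prod ν) := by
    intro t
    push_cast
    rw [← Complex.mul_conj', ← integral_conj, ← integral_prod_mul, ← integral_mul_const]
    refine integral_congr_ae (ae_of_all _ fun p => ?_)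
    simp only [hF, map_mul, ← Complex.exp_conj]
    push_cast
    simp only [map_neg, Complex.conj_I, Complex.conj_ofReal, neg_neg]
    have : Complex.exp (-Complex.I * t * (φ p.1 - φ p.2))
        = Complex.exp (-Complex.I * t * φ p.1) * Complex.exp (Complex.I * t * φ p.2) := by
      rw [← Complex.exp_add]; ring_nf
    rw [this]
    ring
  rw [← integral_complex_ofReal]
  simp_rw [h1]
  rw [integral_integral_swap hFi]
  refine integral_congr_ae (ae_of_all _ fun p => ?_)
  simp only [hF]
  rw [integral_const_mul, integral_gaussian_mul_cexp hT]

/-- A mean value bound with Gaussian weight, with the Schur test applied to the kernel. -/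
theorem gaussian_mean_square_le (hT : 0 < T) (hφ : Measurable φ) (hg : Integrable g ν)
    (hg2 : Integrable (fun u => ‖g u‖ ^ 2) ν)
    (hk : ∀ᵐ u ∂ν, Integrable (fun v => Real.exp (-(T * (φ u - φ v)) ^ 2 / 4)) ν ∧
      ∫ v, Real.exp (-(T * (φ u - φ v)) ^ 2 / 4) ∂ν ≤ B) :
    ∫ t : ℝ, ‖∫ u, g u * Complex.exp (-Complex.I * t * φ u) ∂ν‖ ^ 2 * Real.exp (-(t / T) ^ 2)
      ≤ T * √Real.pi * (B * ∫ u, ‖g u‖ ^ 2 ∂ν) := by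
  set k : α × α → ℝ := fun p => Real.exp (-(T * (φ p.1 - φ p.2)) ^ 2 / 4) with hkdef
  have hkm : Measurable k := by fun_prop
  have hk0 : ∀ p, 0 ≤ k p := fun p => (Real.exp_pos _).le
  have hksymm : ∀ p, k p.swap = k p := by
    intro p
    simp only [hkdef, Prod.fst_swap, Prod.snd_swap]
    congr 2
    ring
  have hA : Integrable (fun p : α × α => ‖g p.1‖ ^ 2 * k p) (ν.prod ν) := by
    have hm : AEStronglyMeasurable (fun p : α × α => ‖g p.1‖ ^ 2 * k p) (ν.prod ν) :=
      (hg2.aestronglyMeasurable.comp_fst).mul hkm.aestronglyMeasurable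
    refine (integrable_prod_iff hm).2 ⟨?_, ?_⟩
    · filter_upwards [hk] with u hu using hu.1.const_mul _
    · refine Integrable.mono' (hg2.mul_const B) hm.norm.integral_prod_right' ?_
      filter_upwards [hk] with u hu
      have : ∀ v, ‖‖g u‖ ^ 2 * k (u, v)‖ = ‖g u‖ ^ 2 * k (u, v) := fun v =>
        Real.norm_of_nonneg (mul_nonneg (sq_nonneg _) (hk0 _))
      simp only [this]
      rw [integral_const_mul, Real.norm_of_nonneg
        (mul_nonneg (sq_nonneg _) (integral_nonneg fun v => hk0 _))]
      exact mul_le_mul_of_nonneg_left hu.2 (sq_nonneg _)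
  have hAint : ∫ p : α × α, ‖g p.1‖ ^ 2 * k p ∂(ν.prod ν) ≤ B * ∫ u, ‖g u‖ ^ 2 ∂ν := by
    rw [integral_prod _ hA, ← integral_const_mul]
    refine integral_mono_ae hA.integral_prod_left (hg2.const_mul B) ?_
    filter_upwards [hk] with u hu
    rw [integral_const_mul, mul_comm]
    exact mul_le_mul_of_nonneg_right hu.2 (sq_nonneg _)
  have hA' : Integrable (fun p : α × α => ‖g p.2‖ ^ 2 * k p) (ν.prod ν) := by
    refine hA.swap.congr (ae_of_all _ fun p => ?_)
    simp only [Function.comp, Prod.fst_swap, hksymm]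
  have hAint' : ∫ p : α × α, ‖g p.2‖ ^ 2 * k p ∂(ν.prod ν)
      = ∫ p : α × α, ‖g p.1‖ ^ 2 * k p ∂(ν.prod ν) := by
    rw [← integral_prod_swap]
    refine integral_congr_ae (ae_of_all _ fun p => ?_)
    simp only [Prod.snd_swap, hksymm]
  have hI0 : 0 ≤ ∫ t : ℝ, ‖∫ u, g u * Complex.exp (-Complex.I * t * φ u) ∂ν‖ ^ 2
      * Real.exp (-(t / T) ^ 2) := integral_nonneg fun t => by positivity
  have key := congrArg norm (gaussian_mean_square_eq hT hφ hg)
  rw [Complex.norm_real, Real.norm_of_nonneg hI0] at key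
  rw [key]
  have hTp : 0 ≤ T * √Real.pi := by positivity
  -- Schur test: `|g(u) g(v)| ≤ (|g(u)|² + |g(v)|²)/2`, and the symmetry of the kernel makes both
  -- halves equal.
  calc _ ≤ ∫ p : α × α, T * √Real.pi * ((‖g p.1‖ ^ 2 * k p + ‖g p.2‖ ^ 2 * k p) / 2) ∂(ν.prod ν) := by
        refine norm_integral_le_of_norm_le (((hA.add hA').div_const 2).const_mul _)
          (ae_of_all _ fun p => ?_)
        rw [norm_mul, norm_mul, RCLike.norm_conj, Complex.norm_real,
          Real.norm_of_nonneg (mul_nonneg hTp (hk0 p))]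
        have : ‖g p.1‖ * ‖g p.2‖ ≤ (‖g p.1‖ ^ 2 + ‖g p.2‖ ^ 2) / 2 := by
          nlinarith [sq_nonneg (‖g p.1‖ - ‖g p.2‖)]
        calc _ ≤ (‖g p.1‖ ^ 2 + ‖g p.2‖ ^ 2) / 2 * (T * √Real.pi * k p) :=
              mul_le_mul_of_nonneg_right this (mul_nonneg hTp (hk0 p))
          _ = _ := by ring
    _ = T * √Real.pi * ∫ p : α × α, ‖g p.1‖ ^ 2 * k p ∂(ν.prod ν) := by
        rw [integral_const_mul, integral_div, integral_add hA hA', hAint']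
        ring
    _ ≤ _ := mul_le_mul_of_nonneg_left hAint hTp

end MeanSquare

/-! ### Mean square of `ζ` on vertical lines -/

lemma integral_kernel_volume {T : ℝ} (hT : 0 < T) (u : ℝ) :
    Integrable (fun v : ℝ => Real.exp (-(T * (u - v)) ^ 2 / 4)) ∧
      ∫ v : ℝ, Real.exp (-(T * (u - v)) ^ 2 / 4) = 2 * √Real.pi / T := by
  have e : ∀ v : ℝ, Real.exp (-(T * (u - v)) ^ 2 / 4)
      = (fun x : ℝ => Real.exp (-(T ^ 2 / 4) * x ^ 2)) (u - v) := fun v => by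
    simp only; congr 1; ring
  simp_rw [e]
  refine ⟨(integrable_exp_neg_mul_sq (by positivity)).comp_sub_left u, ?_⟩
  rw [integral_sub_left_eq_self (fun x : ℝ => Real.exp (-(T ^ 2 / 4) * x ^ 2)), integral_gaussian,
    show Real.pi / (T ^ 2 / 4) = Real.pi * (2 / T) ^ 2 by field_simp; norm_num,
    Real.sqrt_mul Real.pi_pos.le, Real.sqrt_sq (by positivity)]
  ring

lemma fractTail_eq_integral_cexp (a σ t : ℝ) :
    fractTail a (σ + Complex.I * t) = ∫ p in Ioi a,
      ((Int.fract (Real.exp p) : ℝ) : ℂ) * Complex.exp (-(σ : ℂ) * p)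
        * Complex.exp (-Complex.I * t * (id p : ℝ)) := by
  refine setIntegral_congr_fun measurableSet_Ioi fun p _ => ?_
  simp only [id]
  rw [mul_assoc, ← Complex.exp_add]
  ring_nf

lemma fractTail_integrable_mean_square {a σ T : ℝ} (hσ : 0 < σ) (hT : 0 < T) :
    Integrable fun t : ℝ => ‖fractTail a (σ + Complex.I * t)‖ ^ 2 * Real.exp (-(t / T) ^ 2) := by
  simp_rw [fractTail_eq_integral_cexp]
  exact integrable_gaussian_mean_square hT measurable_id
    (integrableOn_fract_mul_exp a (s := σ) (by simpa using hσ))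

/-- The kernel mass `2√π / T` cancels the factor `T√π`, so the bound does not depend on `T`. -/
lemma fractTail_mean_square_le {a σ T : ℝ} (hσ : 0 < σ) (hT : 0 < T) :
    ∫ t : ℝ, ‖fractTail a (σ + Complex.I * t)‖ ^ 2 * Real.exp (-(t / T) ^ 2)
      ≤ Real.pi * Real.exp (-(2 * σ) * a) / σ := by
  simp_rw [fractTail_eq_integral_cexp]
  have hgi := integrableOn_fract_mul_exp a (s := σ) (by simpa using hσ)
  have hb : ∀ p : ℝ, ‖((Int.fract (Real.exp p) : ℝ) : ℂ) * Complex.exp (-(σ : ℂ) * p)‖ ^ 2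
      ≤ Real.exp (-(2 * σ) * p) := by
    intro p
    have := norm_fract_mul_exp_le (σ : ℂ) p
    rw [Complex.ofReal_re] at this
    calc _ ≤ Real.exp (-σ * p) ^ 2 := by gcongr
      _ = _ := by rw [← Real.exp_nat_mul]; congr 1; push_cast; ring
  have hei : IntegrableOn (fun p : ℝ => Real.exp (-(2 * σ) * p)) (Ioi a) :=
    exp_neg_integrableOn_Ioi a (by linarith)
  have hg2 : Integrable (fun p : ℝ =>
      ‖((Int.fract (Real.exp p) : ℝ) : ℂ) * Complex.exp (-(σ : ℂ) * p)‖ ^ 2)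
      (volume.restrict (Ioi a)) := by
    refine Integrable.mono' hei (hgi.aestronglyMeasurable.norm.pow 2) (ae_of_all _ fun p => ?_)
    rw [Real.norm_of_nonneg (sq_nonneg _)]
    exact hb p
  refine (gaussian_mean_square_le (B := 2 * √Real.pi / T) hT measurable_id hgi hg2
    (ae_of_all _ fun u => ?_)).trans ?_
  · obtain ⟨h1, h2⟩ := integral_kernel_volume hT u
    exact ⟨h1.integrableOn, h2 ▸ setIntegral_le_integral h1 (ae_of_all _ fun v => (Real.exp_pos _).le)⟩
  · have h3 : ∫ p in Ioi a, ‖((Int.fract (Real.exp p) : ℝ) : ℂ) * Complex.exp (-(σ : ℂ) * p)‖ ^ 2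
        ≤ Real.exp (-(2 * σ) * a) / (2 * σ) := by
      refine (integral_mono hg2 hei hb).trans_eq ?_
      rw [integral_exp_mul_Ioi (by linarith)]
      field_simp
    calc _ ≤ T * √Real.pi * (2 * √Real.pi / T * (Real.exp (-(2 * σ) * a) / (2 * σ))) := by gcongr
      _ = √Real.pi ^ 2 * Real.exp (-(2 * σ) * a) / σ := by field_simp
      _ = _ := by rw [Real.sq_sqrt Real.pi_pos.le]

lemma summable_exp_neg_sq_div : Summable fun h : ℤ => Real.exp (-(h : ℝ) ^ 2 / 16) := by
  have hn : Summable fun n : ℕ => Real.exp (-(n : ℝ) ^ 2 / 16) := by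
    refine Summable.of_nonneg_of_le (fun n => (Real.exp_pos _).le) (fun n => ?_)
      (summable_geometric_of_lt_one (Real.exp_pos (-(1 / 16))).le (by
        rw [Real.exp_lt_one_iff]; norm_num))
    rw [← Real.exp_nat_mul]
    refine Real.exp_le_exp.2 ?_
    have : (n : ℝ) ≤ (n : ℝ) ^ 2 := by exact_mod_cast Nat.le_self_pow two_ne_zero n
    linarith
  refine Summable.of_nat_of_neg ?_ ?_
  · simpa using hn
  · simpa using hn

/-- Logarithms of integers up to `X ≤ 2T` satisfy `T |log m - log n| ≥ |m - n| / 2`, so the kernel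
is dominated by a Gaussian in `h = m - n`, summable over all integers `h` with a bound free of `m`,
`X` and `T`. -/
lemma sum_kernel_log_le {X m : ℕ} {T : ℝ} (hT : 0 < T) (hXT : (X : ℝ) ≤ 2 * T)
    (hm : m ∈ Finset.Icc 1 X) :
    ∑ n ∈ Finset.Icc 1 X, Real.exp (-(T * (Real.log m - Real.log n)) ^ 2 / 4)
      ≤ ∑' h : ℤ, Real.exp (-(h : ℝ) ^ 2 / 16) := by
  have hlog : ∀ {a b : ℕ}, 1 ≤ a → a ≤ b → b ≤ X →
      ((b : ℝ) - a) / X ≤ Real.log b - Real.log a := by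
    intro a b ha hab hb
    have ha0 : (0 : ℝ) < a := by exact_mod_cast ha
    have hb0 : (0 : ℝ) < b := by exact_mod_cast ha.trans hab
    have hbX : (b : ℝ) ≤ X := by exact_mod_cast hb
    have hab' : (a : ℝ) ≤ b := by exact_mod_cast hab
    have h1 := Real.one_sub_inv_le_log_of_pos (x := (b : ℝ) / a) (by positivity)
    rw [Real.log_div hb0.ne' ha0.ne', inv_div] at h1
    refine le_trans ?_ h1
    calc ((b : ℝ) - a) / X ≤ ((b : ℝ) - a) / b :=
          div_le_div_of_nonneg_left (by linarith) hb0 hbX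
      _ = _ := by field_simp
  have hX0 : (0 : ℝ) < X := by
    have := Finset.mem_Icc.1 hm
    exact_mod_cast this.1.trans this.2
  have key : ∀ n ∈ Finset.Icc 1 X, Real.exp (-(T * (Real.log m - Real.log n)) ^ 2 / 4)
      ≤ (fun h : ℤ => Real.exp (-(h : ℝ) ^ 2 / 16)) ((m : ℤ) - n) := by
    intro n hn
    rw [Finset.mem_Icc] at hn hm
    refine Real.exp_le_exp.2 ?_
    have h1 : |(m : ℝ) - n| / X ≤ |Real.log m - Real.log n| := by
      rcases le_total m n with h | h
      · have h' : (m : ℝ) ≤ n := by exact_mod_cast h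
        rw [abs_sub_comm, abs_of_nonneg (by linarith), abs_sub_comm]
        exact (hlog hm.1 h hn.2).trans (le_abs_self _)
      · have h' : (n : ℝ) ≤ m := by exact_mod_cast h
        rw [abs_of_nonneg (by linarith)]
        exact (hlog hn.1 h hm.2).trans (le_abs_self _)
    have h2 : |(m : ℝ) - n| / 2 ≤ T * |Real.log m - Real.log n| := by
      calc |(m : ℝ) - n| / 2 ≤ T * (|(m : ℝ) - n| / X) := by
            rw [div_le_iff₀ two_pos, mul_div_assoc', div_mul_eq_mul_div, le_div_iff₀ hX0]
            nlinarith [abs_nonneg ((m : ℝ) - n)]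
        _ ≤ _ := by gcongr
    have h3 := mul_self_le_mul_self (by positivity) h2
    have h4 : (T * |Real.log m - Real.log n|) * (T * |Real.log m - Real.log n|)
        = (T * (Real.log m - Real.log n)) ^ 2 := by
      rw [← sq, mul_pow, sq_abs, mul_pow]
    have h5 : |(m : ℝ) - n| / 2 * (|(m : ℝ) - n| / 2) = ((m : ℝ) - n) ^ 2 / 4 := by
      rw [← sq, div_pow, sq_abs]; norm_num
    push_cast
    linarith
  refine (Finset.sum_le_sum key).trans ?_
  rw [← Finset.sum_image (g := fun n : ℕ => (m : ℤ) - n)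
    (f := fun h : ℤ => Real.exp (-(h : ℝ) ^ 2 / 16)) (fun a _ b _ h => by simpa using h)]
  exact summable_exp_neg_sq_div.sum_le_tsum _ fun _ _ => (Real.exp_pos _).le

/-- Finite sums are written as integrals against counting measure so that the general mean value
theorem applies to them. -/
lemma integrable_count_Icc {E : Type*} [NormedAddCommGroup E]
    (X : ℕ) (f : ℕ → E) :
    Integrable f (Measure.count.restrict (↑(Finset.Icc 1 X) : Set ℕ)) := by
  have h : IntegrableOn f (⋃ n ∈ (↑(Finset.Icc 1 X) : Set ℕ), {n}) Measure.count :=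
    (integrableOn_finite_biUnion (Finset.finite_toSet _)).2 fun n _ =>
      integrableOn_singleton (hx := by simp)
  rwa [Set.biUnion_of_singleton] at h

lemma integral_count_Icc {E : Type*} [NormedAddCommGroup E] [NormedSpace ℝ E] [CompleteSpace E]
    (X : ℕ) (f : ℕ → E) :
    ∫ n, f n ∂(Measure.count.restrict (↑(Finset.Icc 1 X) : Set ℕ)) = ∑ n ∈ Finset.Icc 1 X, f n := by
  rw [setIntegral_finset _ (integrable_count_Icc X f)]
  simp

lemma sum_cpow_eq_integral_cexp (X : ℕ) (σ t : ℝ) :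
    ∑ n ∈ Finset.Icc 1 X, (n : ℂ) ^ (-(σ + Complex.I * t : ℂ))
      = ∫ n, (n : ℂ) ^ (-(σ : ℂ)) * Complex.exp (-Complex.I * t * (Real.log n : ℝ))
        ∂(Measure.count.restrict (↑(Finset.Icc 1 X) : Set ℕ)) := by
  rw [integral_count_Icc]
  refine Finset.sum_congr rfl fun n hn => ?_
  have hn0 : (n : ℂ) ≠ 0 := by
    have := (Finset.mem_Icc.1 hn).1
    exact_mod_cast (by omega : n ≠ 0)
  rw [neg_add, Complex.cpow_add _ _ hn0, Complex.cpow_def_of_ne_zero hn0 (-(Complex.I * t)),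
    Complex.natCast_log]
  ring_nf

lemma integrable_dirichlet_mean_square (X : ℕ) (σ : ℝ) {T : ℝ} (hT : 0 < T) :
    Integrable fun t : ℝ => ‖∑ n ∈ Finset.Icc 1 X, (n : ℂ) ^ (-(σ + Complex.I * t : ℂ))‖ ^ 2
      * Real.exp (-(t / T) ^ 2) := by
  simp_rw [sum_cpow_eq_integral_cexp]
  exact integrable_gaussian_mean_square hT (φ := fun n : ℕ => Real.log n) (measurable_of_countable _)
    (integrable_count_Icc X _)

lemma dirichlet_mean_square_le {X : ℕ} {σ T : ℝ} (hT : 0 < T) (hXT : (X : ℝ) ≤ 2 * T)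
    (hσ : 1 / 2 ≤ σ) :
    ∫ t : ℝ, ‖∑ n ∈ Finset.Icc 1 X, (n : ℂ) ^ (-(σ + Complex.I * t : ℂ))‖ ^ 2
        * Real.exp (-(t / T) ^ 2)
      ≤ T * √Real.pi * ((∑' h : ℤ, Real.exp (-(h : ℝ) ^ 2 / 16)) * (1 + Real.log X)) := by
  simp_rw [sum_cpow_eq_integral_cexp]
  refine (gaussian_mean_square_le (B := ∑' h : ℤ, Real.exp (-(h : ℝ) ^ 2 / 16)) hT
    (φ := fun n : ℕ => Real.log n) (measurable_of_countable _) (integrable_count_Icc X _)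
    (integrable_count_Icc X _) ?_).trans ?_
  · refine (ae_restrict_iff' (Finset.measurableSet _)).2 (ae_of_all _ fun m hm => ?_)
    refine ⟨integrable_count_Icc X _, ?_⟩
    rw [integral_count_Icc]
    exact sum_kernel_log_le hT hXT hm
  · have hB : 0 ≤ ∑' h : ℤ, Real.exp (-(h : ℝ) ^ 2 / 16) := tsum_nonneg fun _ => (Real.exp_pos _).le
    rw [integral_count_Icc]
    gcongr
    have h1 := harmonic_le_one_add_log X
    rw [harmonic_eq_sum_Icc] at h1
    push_cast at h1
    refine le_trans (Finset.sum_le_sum fun n hn => ?_) h1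
    have hn1 : 1 ≤ n := (Finset.mem_Icc.1 hn).1
    have hn1' : (1 : ℝ) ≤ n := by exact_mod_cast hn1
    rw [Complex.norm_natCast_cpow_of_pos hn1, ← Real.rpow_natCast, ← Real.rpow_mul (by positivity),
      ← Real.rpow_neg_one]
    refine Real.rpow_le_rpow_of_exponent_le hn1' ?_
    simp
    linarith

/-- The mean square of the zeta function on vertical lines in `1/2 ≤ σ ≤ 2`. -/
theorem exists_riemannZeta_mean_square_le :
    ∃ C : ℝ, 0 < C ∧ ∀ T : ℝ, 1 ≤ T → ∀ σ ∈ Icc (1 / 2 : ℝ) 2,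
      ∫ t in T..2 * T, ‖riemannZeta (σ + Complex.I * t)‖ ^ 2 ≤ C * (T * (1 + Real.log T)) := by
  set B := ∑' h : ℤ, Real.exp (-(h : ℝ) ^ 2 / 16) with hBdef
  have hB : 0 ≤ B := tsum_nonneg fun _ => (Real.exp_pos _).le
  -- Here `3` comes from `(a+b+c)² ≤ 3(a²+b²+c²)`, `e⁴` from the Gaussian weight on `[T, 2T]`, `8`
  -- from `|s|² ≤ 8T²`, and `6 = 3 · 2` from the pole term.
  refine ⟨3 * Real.exp 4 * (√Real.pi * (B * 2) + 8 * (2 * Real.pi)) + 6, by positivity, ?_⟩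
  rintro T hT σ ⟨hσ1, hσ2⟩
  have hT0 : 0 < T := by linarith
  -- `X ≤ 2T` is what the kernel bound requires, while `X ≥ T` makes the tail term, of size `T²
  -- X^{-2σ}`, at most `O(T)`.
  set X := ⌈T⌉₊ with hX
  have hXl : T ≤ X := Nat.le_ceil T
  have hXu : (X : ℝ) ≤ 2 * T := by linarith [Nat.ceil_lt_add_one hT0.le]
  have hX1 : 1 ≤ X := by exact_mod_cast hT.trans hXl
  have hX1' : (1 : ℝ) ≤ X := hT.trans hXl
  have hlogT : 0 ≤ Real.log T := Real.log_nonneg hT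
  have hlogX : Real.log X ≤ 1 + Real.log T := by
    refine (Real.log_le_log (by linarith) hXu).trans ?_
    rw [Real.log_mul two_ne_zero hT0.ne']
    linarith [Real.log_two_lt_d9]
  set D : ℝ → ℂ := fun t => ∑ n ∈ Finset.Icc 1 X, (n : ℂ) ^ (-(σ + Complex.I * t : ℂ)) with hD
  set R : ℝ → ℂ := fun t => fractTail (Real.log X) (σ + Complex.I * t) with hR
  set w : ℝ → ℝ := fun t => Real.exp (-(t / T) ^ 2) with hw
  have hDi : Integrable fun t => ‖D t‖ ^ 2 * w t := integrable_dirichlet_mean_square X σ hT0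
  have hRi : Integrable fun t => ‖R t‖ ^ 2 * w t :=
    fractTail_integrable_mean_square (by linarith) hT0
  have hDle : ∫ t, ‖D t‖ ^ 2 * w t ≤ T * √Real.pi * (B * (1 + Real.log X)) :=
    dirichlet_mean_square_le hT0 hXu hσ1
  have hRle : ∫ t, ‖R t‖ ^ 2 * w t ≤ 2 * Real.pi / T := by
    refine (fractTail_mean_square_le (by linarith) hT0).trans ?_
    have h1 : Real.exp (-(2 * σ) * Real.log X) ≤ 1 / T := by
      calc Real.exp (-(2 * σ) * Real.log X) ≤ Real.exp (-Real.log X) :=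
            Real.exp_le_exp.2 (by nlinarith [Real.log_nonneg hX1'])
        _ = 1 / X := by rw [Real.exp_neg, Real.exp_log (by linarith), one_div]
        _ ≤ 1 / T := one_div_le_one_div_of_le hT0 hXl
    rw [div_le_div_iff₀ (by linarith) hT0]
    rw [le_div_iff₀ hT0] at h1
    nlinarith [Real.pi_pos]
  have hpt : ∀ t ∈ Icc T (2 * T), ‖riemannZeta (σ + Complex.I * t)‖ ^ 2
      ≤ 3 * Real.exp 4 * (‖D t‖ ^ 2 * w t + 8 * T ^ 2 * (‖R t‖ ^ 2 * w t)) + 6 := by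
    rintro t ⟨ht1, ht2⟩
    set s : ℂ := σ + Complex.I * t with hs
    have hre : s.re = σ := by simp [hs]
    have him : s.im = t := by simp [hs]
    have hs1 : s ≠ 1 := by
      intro h
      have := congrArg Complex.im h
      rw [him] at this
      simp at this
      linarith
    have hP : ‖(X : ℂ) ^ (1 - s) / (s - 1)‖ ^ 2 ≤ 2 := by
      have hn : T ≤ ‖s - 1‖ := by
        have := Complex.abs_im_le_norm (s - 1)
        rw [Complex.sub_im, him, Complex.one_im, sub_zero, abs_of_nonneg (by linarith)] at this
        linarith
      have hx : ‖(X : ℂ) ^ (1 - s)‖ ^ 2 ≤ X := by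
        rw [Complex.norm_natCast_cpow_of_pos hX1, ← Real.rpow_natCast,
          ← Real.rpow_mul (by positivity)]
        calc _ ≤ (X : ℝ) ^ (1 : ℝ) := by
              refine Real.rpow_le_rpow_of_exponent_le hX1' ?_
              simp [hre]
              linarith
          _ = X := Real.rpow_one _
      rw [norm_div, div_pow, div_le_iff₀ (pow_pos (hT0.trans_le hn) 2)]
      nlinarith
    have hsn : ‖s‖ ^ 2 ≤ 8 * T ^ 2 := by
      rw [← Complex.normSq_eq_norm_sq, Complex.normSq_apply, hre, him]
      nlinarith
    have hwt : 1 ≤ Real.exp 4 * w t := by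
      rw [hw, ← Real.exp_add]
      refine Real.one_le_exp ?_
      have : t / T ≤ 2 := by rwa [div_le_iff₀ hT0]
      have : 0 ≤ t / T := div_nonneg (by linarith) hT0.le
      nlinarith
    rw [riemannZeta_eq_zetaApprox hX1 (by rw [hre]; linarith) hs1, zetaApprox]
    change ‖D t + _ - s * R t‖ ^ 2 ≤ _
    have h3 : ‖D t + (X : ℂ) ^ (1 - s) / (s - 1) - s * R t‖ ^ 2
        ≤ 3 * (‖D t‖ ^ 2 + ‖(X : ℂ) ^ (1 - s) / (s - 1)‖ ^ 2 + ‖s * R t‖ ^ 2) := by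
      have h4 := (norm_sub_le (D t + (X : ℂ) ^ (1 - s) / (s - 1)) (s * R t)).trans
        (add_le_add_left (norm_add_le _ _) _)
      have h5 := pow_le_pow_left₀ (norm_nonneg _) h4 2
      refine h5.trans ?_
      nlinarith [sq_nonneg (‖D t‖ - ‖(X : ℂ) ^ (1 - s) / (s - 1)‖),
        sq_nonneg (‖D t‖ - ‖s * R t‖), sq_nonneg (‖(X : ℂ) ^ (1 - s) / (s - 1)‖ - ‖s * R t‖)]
    have h6 : ‖s * R t‖ ^ 2 ≤ 8 * T ^ 2 * ‖R t‖ ^ 2 := by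
      rw [norm_mul, mul_pow]; gcongr
    have h7 : ‖D t‖ ^ 2 + 8 * T ^ 2 * ‖R t‖ ^ 2
        ≤ (‖D t‖ ^ 2 + 8 * T ^ 2 * ‖R t‖ ^ 2) * (Real.exp 4 * w t) :=
      le_mul_of_one_le_right (by positivity) hwt
    linarith
  have hle : T ≤ 2 * T := by linarith
  have hbi : Integrable fun t =>
      3 * Real.exp 4 * (‖D t‖ ^ 2 * w t + 8 * T ^ 2 * (‖R t‖ ^ 2 * w t)) :=
    (hDi.add (hRi.const_mul _)).const_mul _
  have hcont : ContinuousOn (fun t : ℝ => ‖riemannZeta (σ + Complex.I * t)‖ ^ 2) (uIcc T (2 * T)) := by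
    refine (ContinuousOn.norm ?_).pow 2
    intro t ht
    rw [uIcc_of_le hle] at ht
    refine ContinuousAt.continuousWithinAt ?_
    refine ContinuousAt.comp (f := fun t : ℝ => (σ + Complex.I * t : ℂ)) (g := riemannZeta)
      (differentiableAt_riemannZeta ?_).continuousAt (by fun_prop)
    intro h
    have := congrArg Complex.im h
    simp at this
    linarith [ht.1]
  calc _ ≤ ∫ t in T..2 * T,
        (3 * Real.exp 4 * (‖D t‖ ^ 2 * w t + 8 * T ^ 2 * (‖R t‖ ^ 2 * w t)) + 6) :=
        intervalIntegral.integral_mono_on hle hcont.intervalIntegrable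
          (hbi.intervalIntegrable.add intervalIntegrable_const) hpt
    _ = (∫ t in T..2 * T, 3 * Real.exp 4 * (‖D t‖ ^ 2 * w t + 8 * T ^ 2 * (‖R t‖ ^ 2 * w t)))
        + 6 * T := by
        rw [intervalIntegral.integral_add hbi.intervalIntegrable intervalIntegrable_const,
          intervalIntegral.integral_const, smul_eq_mul]
        ring
    _ ≤ (∫ t, 3 * Real.exp 4 * (‖D t‖ ^ 2 * w t + 8 * T ^ 2 * (‖R t‖ ^ 2 * w t))) + 6 * T := by
        gcongr
        rw [intervalIntegral.integral_of_le hle]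
        refine setIntegral_le_integral hbi (ae_of_all _ fun t => ?_)
        have : 0 ≤ w t := (Real.exp_pos _).le
        simp only [Pi.zero_apply]
        positivity
    _ = 3 * Real.exp 4 * ((∫ t, ‖D t‖ ^ 2 * w t) + 8 * T ^ 2 * ∫ t, ‖R t‖ ^ 2 * w t) + 6 * T := by
        rw [integral_const_mul, integral_add hDi (hRi.const_mul _), integral_const_mul]
    _ ≤ 3 * Real.exp 4 * (T * √Real.pi * (B * (2 * (1 + Real.log T)))
          + 8 * T ^ 2 * (2 * Real.pi / T)) + 6 * T := by
        gcongr
        refine hDle.trans ?_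
        gcongr
        linarith
    _ = 3 * Real.exp 4 * (T * √Real.pi * (B * (2 * (1 + Real.log T)))
          + 8 * (2 * Real.pi) * T) + 6 * T := by field_simp
    _ ≤ 3 * Real.exp 4 * (T * √Real.pi * (B * (2 * (1 + Real.log T)))
          + 8 * (2 * Real.pi) * (T * (1 + Real.log T))) + 6 * (T * (1 + Real.log T)) := by
        have : T ≤ T * (1 + Real.log T) := le_mul_of_one_le_right hT0.le (by linarith)
        gcongr
    _ = _ := by ring

/-! ### Truncated Perron integral -/

lemma mul_exp_neg_le {c u : ℝ} (hc : 0 < c) :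
    u * Real.exp (-c * u) ≤ 2 / c * Real.exp (-(c / 2) * u) := by
  have h1 : u ≤ 2 / c * Real.exp (c / 2 * u) := by
    rw [div_mul_eq_mul_div, le_div_iff₀ hc]
    nlinarith [Real.add_one_le_exp (c / 2 * u)]
  calc u * Real.exp (-c * u) ≤ 2 / c * Real.exp (c / 2 * u) * Real.exp (-c * u) := by gcongr
    _ = 2 / c * Real.exp (-(c / 2) * u) := by rw [mul_assoc, ← Real.exp_add]; ring_nf

lemma integrableOn_mul_cexp_neg {r : ℂ} (hr : 0 < r.re) :
    IntegrableOn (fun u : ℝ => (u : ℂ) * Complex.exp (-r * u)) (Ioi 0) := by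
  refine Integrable.mono' ((exp_neg_integrableOn_Ioi 0 (half_pos hr)).const_mul (2 / r.re))
    (Measurable.aestronglyMeasurable (by fun_prop)) ?_
  refine (ae_restrict_iff' measurableSet_Ioi).2 (ae_of_all _ fun u hu => ?_)
  have hu0 : 0 < u := hu
  rw [norm_mul, Complex.norm_exp, Complex.norm_real, Real.norm_of_nonneg hu0.le]
  simpa using mul_exp_neg_le (u := u) hr

lemma integral_mul_cexp_neg {r : ℂ} (hr : 0 < r.re) :
    ∫ u in Ioi (0 : ℝ), (u : ℂ) * Complex.exp (-r * u) = (r ^ 2)⁻¹ := by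
  have hr0 : r ≠ 0 := by rintro rfl; simp at hr
  have hd : ∀ u ∈ Ici (0 : ℝ), HasDerivAt
      (fun u : ℝ => -((u : ℂ) / r + 1 / r ^ 2) * Complex.exp (-r * u))
      ((u : ℂ) * Complex.exp (-r * u)) u := by
    intro u _
    have e1 : HasDerivAt (fun u : ℝ => (u : ℂ)) 1 u := Complex.ofRealCLM.hasDerivAt
    have e2 : HasDerivAt (fun u : ℝ => -((u : ℂ) / r + 1 / r ^ 2)) (-(1 / r)) u :=
      ((e1.div_const r).add_const (1 / r ^ 2)).neg
    refine (e2.mul (e1.const_mul (-r)).cexp).congr_deriv ?_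
    field_simp
    ring
  have ht : Tendsto (fun u : ℝ => -((u : ℂ) / r + 1 / r ^ 2) * Complex.exp (-r * u)) atTop (𝓝 0) := by
    have h1 : Tendsto (fun u : ℝ => Real.exp (-(r.re / 2) * u)) atTop (𝓝 0) :=
      Real.tendsto_exp_atBot.comp (tendsto_id.const_mul_atTop_of_neg (by linarith))
    have h2 : Tendsto (fun u : ℝ => Real.exp (-r.re * u)) atTop (𝓝 0) :=
      Real.tendsto_exp_atBot.comp (tendsto_id.const_mul_atTop_of_neg (by linarith))
    have h3 : Tendsto (fun u : ℝ => (2 / r.re * Real.exp (-(r.re / 2) * u)) / ‖r‖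
        + 1 / ‖r‖ ^ 2 * Real.exp (-r.re * u)) atTop (𝓝 0) := by
      have := ((h1.const_mul (2 / r.re)).div_const ‖r‖).add (h2.const_mul (1 / ‖r‖ ^ 2))
      simpa only [mul_zero, zero_div, add_zero] using this
    refine squeeze_zero_norm' ?_ h3
    filter_upwards [eventually_ge_atTop 0] with u hu
    rw [norm_mul, norm_neg, Complex.norm_exp]
    have h4 : ‖(u : ℂ) / r + 1 / r ^ 2‖ ≤ u / ‖r‖ + 1 / ‖r‖ ^ 2 := by
      refine (norm_add_le _ _).trans_eq ?_
      simp [abs_of_nonneg hu]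
    have h5 : (-r * (u : ℂ)).re = -r.re * u := by simp
    rw [h5]
    calc _ ≤ (u / ‖r‖ + 1 / ‖r‖ ^ 2) * Real.exp (-r.re * u) := by gcongr
      _ = (u * Real.exp (-r.re * u)) / ‖r‖ + 1 / ‖r‖ ^ 2 * Real.exp (-r.re * u) := by ring
      _ ≤ _ := add_le_add (div_le_div_of_nonneg_right (mul_exp_neg_le hr) (norm_nonneg _)) le_rfl
  rw [integral_Ioi_of_hasDerivAt_of_tendsto' hd (integrableOn_mul_cexp_neg hr) ht]
  simp

lemma normSq_add_I_mul (c t : ℝ) : ‖(c + Complex.I * t : ℂ)‖ ^ 2 = c ^ 2 + t ^ 2 := by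
  rw [← Complex.normSq_eq_norm_sq, Complex.normSq_apply]
  simp
  ring

lemma add_I_mul_ne_zero {c : ℝ} (hc : 0 < c) (t : ℝ) : (c + Complex.I * t : ℂ) ≠ 0 := by
  intro h
  have := congrArg Complex.re h
  simp at this
  exact hc.ne' this

lemma integrable_inv_add_I_mul_sq {c : ℝ} (hc : 0 < c) :
    Integrable fun t : ℝ => ((c + Complex.I * t : ℂ) ^ 2)⁻¹ := by
  have hm : 0 < min (c ^ 2) 1 := lt_min (by positivity) one_pos
  refine Integrable.mono' (integrable_inv_one_add_sq.const_mul (min (c ^ 2) 1)⁻¹)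
    (Measurable.aestronglyMeasurable (by fun_prop)) (ae_of_all _ fun t => ?_)
  rw [norm_inv, norm_pow, normSq_add_I_mul, ← mul_inv]
  refine inv_anti₀ (by positivity) ?_
  nlinarith [min_le_left (c ^ 2) 1, min_le_right (c ^ 2) 1, sq_nonneg t]

open FourierTransform in
/-- The Fourier transform of `((c + i t) ^ 2)⁻¹`. -/
lemma integral_cexp_mul_inv_sq {c : ℝ} (hc : 0 < c) (L : ℝ) :
    ∫ t : ℝ, Complex.exp (Complex.I * t * L) * ((c + Complex.I * t : ℂ) ^ 2)⁻¹
      = 2 * Real.pi * ((max L 0 * Real.exp (-c * L) : ℝ) : ℂ) := by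
  -- This is `u e^{-cu}` for `u > 0` and `0` otherwise, written with `max` so that continuity is
  -- visible. It and its transform are integrable, so Fourier inversion holds at every point; the
  -- first power of `(c + it)⁻¹` would not be integrable.
  set f : ℝ → ℂ := fun u => ((max u 0 * Real.exp (-c * max u 0) : ℝ) : ℂ) with hf
  have hfc : Continuous f := by fun_prop
  have hind : ∀ ξ : ℝ, (fun u : ℝ => Complex.exp (↑(-2 * Real.pi * u * ξ) * Complex.I) • f u)
      = (Ioi (0 : ℝ)).indicator
        (fun u : ℝ => (u : ℂ) * Complex.exp (-(c + Complex.I * (2 * Real.pi * ξ : ℝ) : ℂ) * u)) := by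
    intro ξ
    funext u
    by_cases hu : 0 < u
    · rw [indicator_of_mem (mem_Ioi.2 hu)]
      simp only [hf, max_eq_left hu.le, smul_eq_mul]
      push_cast
      rw [mul_comm, mul_assoc, ← Complex.exp_add]
      ring_nf
    · rw [indicator_of_notMem (by simpa using hu)]
      simp [hf, max_eq_right (not_lt.1 hu)]
  have hre : ∀ y : ℝ, 0 < (c + Complex.I * y : ℂ).re := fun y => by simpa using hc
  have hfi : Integrable f := by
    have h0 := (integrable_indicator_iff measurableSet_Ioi).2 (integrableOn_mul_cexp_neg
      (hre (2 * Real.pi * 0)))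
    rw [← hind 0] at h0
    simpa using h0
  have hF : 𝓕 f = fun ξ : ℝ => ((c + Complex.I * (2 * Real.pi * ξ : ℝ) : ℂ) ^ 2)⁻¹ := by
    funext ξ
    rw [Real.fourier_real_eq_integral_exp_smul, hind, integral_indicator measurableSet_Ioi,
      integral_mul_cexp_neg (hre _)]
  have hFi : Integrable (𝓕 f) := by
    rw [hF]
    exact (integrable_inv_add_I_mul_sq hc).comp_mul_left' (by positivity)
  have hinv := congrFun (hfc.fourierInv_fourier_eq hfi hFi) L
  rw [Real.fourierInv_eq', hF] at hinv
  have hsub := Measure.integral_comp_mul_left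
    (fun t : ℝ => Complex.exp (Complex.I * t * L) * ((c + Complex.I * t : ℂ) ^ 2)⁻¹) (2 * Real.pi)
  have e1 : (fun ξ : ℝ => Complex.exp (↑(2 * Real.pi * inner ℝ ξ L) * Complex.I) •
      ((c + Complex.I * (2 * Real.pi * ξ : ℝ) : ℂ) ^ 2)⁻¹)
      = fun ξ : ℝ => Complex.exp (Complex.I * (2 * Real.pi * ξ : ℝ) * L) *
        ((c + Complex.I * (2 * Real.pi * ξ : ℝ) : ℂ) ^ 2)⁻¹ := by
    funext ξ
    simp only [smul_eq_mul, RCLike.inner_apply, conj_trivial]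
    push_cast
    ring_nf
  rw [e1, hsub, abs_of_pos (by positivity)] at hinv
  have hpi : (2 * Real.pi : ℂ) ≠ 0 := by exact_mod_cast (by positivity : 2 * Real.pi ≠ 0)
  have e2 : ((max L 0 * Real.exp (-c * L) : ℝ) : ℂ) = f L := by
    rcases le_total L 0 with h | h
    · simp [hf, max_eq_right h]
    · simp [hf, max_eq_left h]
  rw [e2, ← hinv, Complex.real_smul, ← mul_assoc]
  push_cast
  rw [mul_inv_cancel₀ hpi, one_mul]

lemma norm_cexp_I_mul (t L : ℝ) : ‖Complex.exp (Complex.I * t * L)‖ = 1 := by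
  rw [Complex.norm_exp]; simp

lemma abs_le_norm_add_I_mul (c t : ℝ) : |t| ≤ ‖(c + Complex.I * t : ℂ)‖ := by
  simpa using Complex.abs_im_le_norm (c + Complex.I * t : ℂ)

lemma norm_integral_tail_le (c : ℝ) {T : ℝ} (hT : 0 < T) (L : ℝ) :
    ‖(∫ t in Iic (-T), Complex.exp (Complex.I * t * L) * ((c + Complex.I * t : ℂ) ^ 2)⁻¹)
      + ∫ t in Ioi T, Complex.exp (Complex.I * t * L) * ((c + Complex.I * t : ℂ) ^ 2)⁻¹‖
      ≤ 2 / T := by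
  have hpow : IntegrableOn (fun t : ℝ => t ^ (-2 : ℝ)) (Ioi T) :=
    integrableOn_Ioi_rpow_of_lt (by norm_num) hT
  have hpow' : ∫ t in Ioi T, t ^ (-2 : ℝ) = 1 / T := by
    rw [integral_Ioi_rpow_of_lt (by norm_num) hT]
    norm_num [Real.rpow_neg_one]
  have hnorm : ∀ t : ℝ, t ≠ 0 → ‖Complex.exp (Complex.I * t * L) *
      ((c + Complex.I * t : ℂ) ^ 2)⁻¹‖ ≤ (t ^ 2)⁻¹ := by
    intro t ht
    rw [norm_mul, norm_cexp_I_mul, one_mul, norm_inv, norm_pow, normSq_add_I_mul]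
    exact inv_anti₀ (by positivity) (by nlinarith)
  have hrp : ∀ t ∈ Ioi T, t ^ (-2 : ℝ) = (t ^ 2)⁻¹ := fun t ht => by
    rw [Real.rpow_neg (hT.trans ht).le]
    norm_num
  have hb : ‖∫ t in Ioi T, Complex.exp (Complex.I * t * L) *
      ((c + Complex.I * t : ℂ) ^ 2)⁻¹‖ ≤ 1 / T := by
    rw [← hpow']
    refine norm_integral_le_of_norm_le hpow
      ((ae_restrict_iff' measurableSet_Ioi).2 (ae_of_all _ fun t ht => ?_))
    rw [hrp t ht]
    exact hnorm t (hT.trans ht).ne'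
  have hb' : ‖∫ t in Iic (-T), Complex.exp (Complex.I * t * L) *
      ((c + Complex.I * t : ℂ) ^ 2)⁻¹‖ ≤ 1 / T := by
    have h1 := integral_comp_neg_Ioi T
      (fun t : ℝ => Complex.exp (Complex.I * t * L) * ((c + Complex.I * t : ℂ) ^ 2)⁻¹)
    rw [← h1, ← hpow']
    refine norm_integral_le_of_norm_le hpow
      ((ae_restrict_iff' measurableSet_Ioi).2 (ae_of_all _ fun t ht => ?_))
    rw [hrp t ht, ← neg_sq t]
    exact hnorm (-t) (neg_ne_zero.2 (hT.trans ht).ne')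
  calc _ ≤ 1 / T + 1 / T := (norm_add_le _ _).trans (add_le_add hb' hb)
    _ = 2 / T := by ring

/-- The integration by parts replaces `(c + it)⁻¹` by its integrable square and gains a factor
`1/L`. -/
lemma integral_cexp_mul_inv_by_parts {c L : ℝ} (hc : 0 < c) (hL : L ≠ 0) (T : ℝ) :
    ∫ t in (-T)..T, Complex.exp (Complex.I * t * L) * (c + Complex.I * t : ℂ)⁻¹
      = Complex.exp (Complex.I * T * L) / (Complex.I * L) * (c + Complex.I * T : ℂ)⁻¹
        - Complex.exp (Complex.I * (-T : ℝ) * L) / (Complex.I * L) * (c + Complex.I * (-T : ℝ) : ℂ)⁻¹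
        + (L : ℂ)⁻¹ * ∫ t in (-T)..T,
          Complex.exp (Complex.I * t * L) * ((c + Complex.I * t : ℂ) ^ 2)⁻¹ := by
  have hL' : (L : ℂ) ≠ 0 := by exact_mod_cast hL
  have e1 : ∀ t : ℝ, HasDerivAt (fun t : ℝ => (t : ℂ)) 1 t := fun t => Complex.ofRealCLM.hasDerivAt
  have hcont : Continuous fun t : ℝ => (c + Complex.I * t : ℂ)⁻¹ :=
    Continuous.inv₀ (by fun_prop) (add_I_mul_ne_zero hc)
  have hcont2 : Continuous fun t : ℝ => ((c + Complex.I * t : ℂ) ^ 2)⁻¹ :=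
    Continuous.inv₀ (by fun_prop) fun t => pow_ne_zero 2 (add_I_mul_ne_zero hc t)
  have h := intervalIntegral.integral_deriv_mul_eq_sub (a := -T) (b := T)
    (u := fun t : ℝ => Complex.exp (Complex.I * t * L) / (Complex.I * L))
    (u' := fun t : ℝ => Complex.exp (Complex.I * t * L))
    (v := fun t : ℝ => (c + Complex.I * t : ℂ)⁻¹)
    (v' := fun t : ℝ => -Complex.I * ((c + Complex.I * t : ℂ) ^ 2)⁻¹)
    (fun t _ => by
      refine ((((e1 t).const_mul Complex.I).mul_const (L : ℂ)).cexp.div_const _).congr_deriv ?_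
      field_simp)
    (fun t _ => by
      refine ((((e1 t).const_mul Complex.I).const_add (c : ℂ)).inv
        (add_I_mul_ne_zero hc t)).congr_deriv ?_
      rw [mul_one, neg_div, div_eq_mul_inv, neg_mul])
    (Continuous.intervalIntegrable (by fun_prop) _ _)
    (Continuous.intervalIntegrable (by fun_prop) _ _)
  rw [intervalIntegral.integral_add (Continuous.intervalIntegrable (by fun_prop) _ _)
    (Continuous.intervalIntegrable (by fun_prop) _ _)] at h
  rw [← h, ← intervalIntegral.integral_const_mul, add_assoc, left_eq_add,
    ← intervalIntegral.integral_add (Continuous.intervalIntegrable (by fun_prop) _ _)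
    (Continuous.intervalIntegrable (by fun_prop) _ _)]
  refine (intervalIntegral.integral_congr fun t _ => ?_).trans intervalIntegral.integral_zero
  field_simp
  ring

/-- A primitive is `-i log(c + it)`, and the endpoints are conjugate, so the integral equals `2
arg(c + iT)`. -/
lemma norm_integral_inv_le {c : ℝ} (hc : 0 < c) (T : ℝ) :
    ‖∫ t in (-T)..T, (c + Complex.I * t : ℂ)⁻¹‖ ≤ 2 * Real.pi := by
  have e1 : ∀ t : ℝ, HasDerivAt (fun t : ℝ => (t : ℂ)) 1 t := fun t => Complex.ofRealCLM.hasDerivAt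
  have hcont : Continuous fun t : ℝ => (c + Complex.I * t : ℂ)⁻¹ :=
    Continuous.inv₀ (by fun_prop) (add_I_mul_ne_zero hc)
  have hslit : ∀ t : ℝ, (c + Complex.I * t : ℂ) ∈ Complex.slitPlane := fun t =>
    Or.inl (by simpa using hc)
  rw [intervalIntegral.integral_eq_sub_of_hasDerivAt
    (f := fun t : ℝ => -Complex.I * Complex.log (c + Complex.I * t))
    (fun t _ => by
      refine ((((e1 t).const_mul Complex.I).const_add (c : ℂ)).clog_real (hslit t)).const_mul
        (-Complex.I) |>.congr_deriv ?_
      rw [mul_one, div_eq_mul_inv, ← mul_assoc, neg_mul, Complex.I_mul_I, neg_neg, one_mul])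
    (hcont.intervalIntegrable _ _)]
  have hconj : (c + Complex.I * (-T : ℝ) : ℂ) = (starRingEnd ℂ) (c + Complex.I * T) := by
    simp
  have harg : Complex.arg (c + Complex.I * T) ≠ Real.pi :=
    Complex.slitPlane_arg_ne_pi (hslit T)
  rw [hconj, Complex.log_conj _ harg, ← mul_sub, Complex.sub_conj, norm_mul, norm_neg,
    Complex.norm_I, one_mul, norm_mul, Complex.norm_I, mul_one, Complex.norm_real, Complex.log_im,
    norm_mul, Real.norm_ofNat, Real.norm_eq_abs]
  have := Complex.abs_arg_le_pi (c + Complex.I * T)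
  linarith

/-- The truncated Perron integral with its sharp error term. -/
theorem norm_perron_sub_le {c T : ℝ} (hc : 0 < c) (hT : 0 < T) (L : ℝ) :
    ‖(2 * Real.pi : ℂ)⁻¹ * (∫ t in (-T)..T,
        Complex.exp ((c + Complex.I * t) * L) / (c + Complex.I * t))
      - (if 0 ≤ L then 1 else 0)‖ ≤ 8 * Real.exp (c * L) / (1 + T * |L|) := by
  have hcont : Continuous fun t : ℝ => (c + Complex.I * t : ℂ)⁻¹ :=
    Continuous.inv₀ (by fun_prop) (add_I_mul_ne_zero hc)
  have hcont2 : Continuous fun t : ℝ => ((c + Complex.I * t : ℂ) ^ 2)⁻¹ :=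
    Continuous.inv₀ (by fun_prop) fun t => pow_ne_zero 2 (add_I_mul_ne_zero hc t)
  set G : ℂ := ∫ t in (-T)..T, Complex.exp (Complex.I * t * L) * (c + Complex.I * t : ℂ)⁻¹ with hG
  have e0 : (∫ t in (-T)..T, Complex.exp ((c + Complex.I * t) * L) / (c + Complex.I * t))
      = (Real.exp (c * L) : ℝ) * G := by
    rw [hG, ← intervalIntegral.integral_const_mul]
    refine intervalIntegral.integral_congr fun t _ => ?_
    rw [add_mul, Complex.exp_add, div_eq_mul_inv]
    push_cast
    ring
  rw [e0]
  have hE := Real.exp_pos (c * L)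
  have hpi := Real.pi_pos
  have hpi3 := Real.pi_gt_three
  have h2pi : ‖(2 * Real.pi : ℂ)⁻¹‖ = (2 * Real.pi)⁻¹ := by
    rw [norm_inv, norm_mul, Complex.norm_real, Real.norm_of_nonneg hpi.le]; simp
  -- For `T|L| ≤ 1` the denominator is at most `2`, and a bound `O(e^{cL})` is enough: `|e^{itL} -
  -- 1| ≤ |t||L|` and the integral of `(c + it)⁻¹` is bounded. This case contains `L = 0`.
  by_cases hTL : T * |L| ≤ 1
  · have hG1 : ‖G‖ ≤ 2 + 2 * Real.pi := by
      have hsplit : G = (∫ t in (-T)..T, (Complex.exp (Complex.I * t * L) - 1) *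
          (c + Complex.I * t : ℂ)⁻¹) + ∫ t in (-T)..T, (c + Complex.I * t : ℂ)⁻¹ := by
        rw [hG, ← intervalIntegral.integral_add (Continuous.intervalIntegrable (by fun_prop) _ _)
          (hcont.intervalIntegrable _ _)]
        refine intervalIntegral.integral_congr fun t _ => ?_
        ring
      have hfirst : ‖∫ t in (-T)..T, (Complex.exp (Complex.I * t * L) - 1) *
          (c + Complex.I * t : ℂ)⁻¹‖ ≤ |L| * |T - -T| := by
        refine intervalIntegral.norm_integral_le_of_norm_le_const fun t _ => ?_
        have h1 : ‖Complex.exp (Complex.I * t * L) - 1‖ ≤ |t| * |L| := by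
          have := Real.norm_exp_I_mul_ofReal_sub_one_le (x := t * L)
          rw [Real.norm_eq_abs, abs_mul] at this
          push_cast at this
          rwa [← mul_assoc] at this
        rw [norm_mul, norm_inv, ← div_eq_mul_inv, div_le_iff₀
          (norm_pos_iff.2 (add_I_mul_ne_zero hc t))]
        calc _ ≤ |t| * |L| := h1
          _ ≤ ‖(c + Complex.I * t : ℂ)‖ * |L| := by gcongr; exact abs_le_norm_add_I_mul c t
          _ = _ := mul_comm _ _
      have hab : |T - -T| = 2 * T := by rw [abs_of_nonneg (by linarith)]; ring
      rw [hab] at hfirst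
      rw [hsplit]
      refine (norm_add_le _ _).trans (add_le_add (hfirst.trans (by linarith))
        (norm_integral_inv_le hc T))
    have h1 : ‖(if 0 ≤ L then 1 else 0 : ℂ)‖ ≤ Real.exp (c * L) := by
      split_ifs with h
      · simpa using Real.one_le_exp (mul_nonneg hc.le h)
      · simpa using hE.le
    have h2 : ‖(2 * Real.pi : ℂ)⁻¹ * ((Real.exp (c * L) : ℝ) * G)‖ ≤ 2 * Real.exp (c * L) := by
      rw [norm_mul, norm_mul, h2pi, Complex.norm_real, Real.norm_of_nonneg hE.le,
        inv_mul_le_iff₀ (by positivity)]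
      nlinarith
    rw [le_div_iff₀ (by positivity)]
    have h3 := (norm_sub_le ((2 * Real.pi : ℂ)⁻¹ * ((Real.exp (c * L) : ℝ) * G))
      (if 0 ≤ L then 1 else 0 : ℂ)).trans (add_le_add h2 h1)
    calc _ ≤ (2 * Real.exp (c * L) + Real.exp (c * L)) * 2 := by gcongr; linarith
      _ ≤ _ := by linarith
  · push Not at hTL
    have hL : L ≠ 0 := by rintro rfl; simp at hTL; linarith
    have hL' : (L : ℂ) ≠ 0 := by exact_mod_cast hL
    have hLpos : 0 < |L| := abs_pos.2 hL
    set Φ : ℝ → ℂ := fun t => Complex.exp (Complex.I * t * L) * ((c + Complex.I * t : ℂ) ^ 2)⁻¹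
      with hΦ
    have hΦi : Integrable Φ := by
      refine (integrable_inv_add_I_mul_sq hc).bdd_mul (c := 1)
        (Measurable.aestronglyMeasurable (by fun_prop)) (ae_of_all _ fun t => ?_)
      exact (norm_cexp_I_mul t L).le
    have htot : ∫ t, Φ t = (∫ t in (-T)..T, Φ t)
        + ((∫ t in Iic (-T), Φ t) + ∫ t in Ioi T, Φ t) := by
      have h1 := intervalIntegral.integral_Iic_add_Ioi (b := T) hΦi.integrableOn hΦi.integrableOn
      have h2 := intervalIntegral.integral_Iic_sub_Iic (a := -T) (b := T)
        hΦi.integrableOn hΦi.integrableOn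
      rw [← h1, ← h2]
      ring
    have hmid : ∫ t in (-T)..T, Φ t = 2 * Real.pi * ((max L 0 * Real.exp (-c * L) : ℝ) : ℂ)
        - ((∫ t in Iic (-T), Φ t) + ∫ t in Ioi T, Φ t) := by
      rw [← integral_cexp_mul_inv_sq hc L, htot]
      ring
    have hparts := integral_cexp_mul_inv_by_parts hc hL T
    rw [← hG, hmid] at hparts
    have htail := norm_integral_tail_le c hT L
    set τ : ℂ := (∫ t in Iic (-T), Φ t) + ∫ t in Ioi T, Φ t with hτ
    set b₁ : ℂ := Complex.exp (Complex.I * T * L) / (Complex.I * L) * (c + Complex.I * T : ℂ)⁻¹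
      with hb₁
    set b₂ : ℂ := Complex.exp (Complex.I * (-T : ℝ) * L) / (Complex.I * L) *
      (c + Complex.I * (-T : ℝ) : ℂ)⁻¹ with hb₂
    have hbd : ∀ t : ℝ, |t| = T → ‖Complex.exp (Complex.I * t * L) / (Complex.I * L) *
        (c + Complex.I * t : ℂ)⁻¹‖ ≤ 1 / (T * |L|) := by
      intro t ht
      rw [norm_mul, norm_div, norm_cexp_I_mul, norm_mul, Complex.norm_I, one_mul, norm_inv,
        Complex.norm_real, Real.norm_eq_abs, ← div_eq_mul_inv, div_div, mul_comm T]
      refine one_div_le_one_div_of_le (by positivity) ?_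
      gcongr
      exact ht ▸ abs_le_norm_add_I_mul c t
    have hb1 := hbd T (abs_of_pos hT)
    have hb2 := hbd (-T) (by rw [abs_neg, abs_of_pos hT])
    -- The complete integral of the squared kernel reproduces the indicator exactly, so only the two
    -- boundary terms and the tails beyond `±T` survive.
    have hmain : (2 * Real.pi : ℂ)⁻¹ * ((Real.exp (c * L) : ℝ) * G) - (if 0 ≤ L then 1 else 0)
        = (2 * Real.pi : ℂ)⁻¹ * ((Real.exp (c * L) : ℝ) * (b₁ - b₂ - (L : ℂ)⁻¹ * τ)) := by
      have hpic : (Real.pi : ℂ) ≠ 0 := by exact_mod_cast hpi.ne'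
      have hone : ((max L 0 * Real.exp (-c * L) : ℝ) : ℂ) * (Real.exp (c * L) : ℝ)
          = L * (if 0 ≤ L then 1 else 0) := by
        rw [← Complex.ofReal_mul, mul_assoc, ← Real.exp_add]
        have : -c * L + c * L = 0 := by ring
        rw [this, Real.exp_zero, mul_one]
        split_ifs with h
        · rw [max_eq_left h, mul_one]
        · rw [max_eq_right (not_le.1 h).le, mul_zero, Complex.ofReal_zero]
      rw [hparts]
      generalize (if 0 ≤ L then 1 else 0 : ℂ) = χ at *
      generalize ((max L 0 * Real.exp (-c * L) : ℝ) : ℂ) = m at *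
      field_simp
      linear_combination (2 * Real.pi : ℂ) * hone
    rw [hmain, norm_mul, norm_mul, h2pi, Complex.norm_real, Real.norm_of_nonneg hE.le]
    have hsum : ‖b₁ - b₂ - (L : ℂ)⁻¹ * τ‖ ≤ 4 / (T * |L|) := by
      have h1 : ‖(L : ℂ)⁻¹ * τ‖ ≤ 2 / (T * |L|) := by
        rw [norm_mul, norm_inv, Complex.norm_real, Real.norm_eq_abs]
        calc |L|⁻¹ * ‖τ‖ ≤ |L|⁻¹ * (2 / T) := by gcongr
          _ = _ := by field_simp
      calc _ ≤ 1 / (T * |L|) + 1 / (T * |L|) + 2 / (T * |L|) :=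
            (norm_sub_le _ _).trans (add_le_add ((norm_sub_le _ _).trans (add_le_add hb1 hb2)) h1)
        _ = _ := by ring
    have hTL0 : 0 < T * |L| := by positivity
    calc (2 * Real.pi)⁻¹ * (Real.exp (c * L) * ‖b₁ - b₂ - (L : ℂ)⁻¹ * τ‖)
        ≤ 1 * (Real.exp (c * L) * (4 / (T * |L|))) := by
          gcongr
          exact inv_le_one_of_one_le₀ (by linarith)
      _ = 4 * Real.exp (c * L) / (T * |L|) := by ring
      _ ≤ _ := by
          rw [div_le_div_iff₀ hTL0 (by linarith)]
          nlinarith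

/-! ### Coefficients of `ζ(s) M(s,N)²` -/

open scoped ArithmeticFunction.zeta ArithmeticFunction.Moebius


/-- The Möbius function restricted to `n ≤ N`. -/
def moebiusTrunc (N : ℕ) : ArithmeticFunction ℤ :=
  ⟨fun n => if n ≤ N then μ n else 0, by simp⟩

lemma moebiusTrunc_apply (N n : ℕ) : moebiusTrunc N n = if n ≤ N then μ n else 0 := rfl

/-- The Dirichlet coefficients of `ζ(s) M(s, N)²`. -/
def mertensCoeff (N : ℕ) : ArithmeticFunction ℤ :=
  moebiusTrunc N * moebiusTrunc N * (ζ : ArithmeticFunction ℤ)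

lemma sum_Ioc_divisorsAntidiagonal {M : Type*} [AddCommMonoid M] (F : ℕ → ℕ → M) (X : ℕ) :
    ∑ k ∈ Finset.Ioc 0 X, ∑ p ∈ k.divisorsAntidiagonal, F p.1 p.2
      = ∑ p ∈ Finset.Ioc 0 X ×ˢ Finset.Ioc 0 X with p.1 * p.2 ≤ X, F p.1 p.2 := by
  trans ∑ k ∈ Finset.Ioc 0 X, ∑ p ∈ Finset.Ioc 0 X ×ˢ Finset.Ioc 0 X with p.1 * p.2 = k, F p.1 p.2
  · refine Finset.sum_congr rfl fun k hk => ?_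
    rw [Finset.mem_Ioc] at hk
    rw [Nat.divisorsAntidiagonal_eq_prod_filter_of_le hk.1.ne' hk.2]
  · simp_rw [Finset.sum_filter]
    rw [Finset.sum_comm]
    exact Finset.sum_congr rfl fun _ _ => by simp_all

lemma abs_mul_apply_le {f g F G : ArithmeticFunction ℤ} (hf : ∀ n, |f n| ≤ F n)
    (hg : ∀ n, |g n| ≤ G n) (k : ℕ) : |(f * g) k| ≤ (F * G) k := by
  rw [ArithmeticFunction.mul_apply, ArithmeticFunction.mul_apply]
  refine (Finset.abs_sum_le_sum_abs _ _).trans (Finset.sum_le_sum fun p _ => ?_)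
  rw [abs_mul]
  exact mul_le_mul (hf _) (hg _) (abs_nonneg _) ((abs_nonneg _).trans (hf _))

lemma abs_moebiusTrunc_le (N n : ℕ) : |moebiusTrunc N n| ≤ (ζ : ArithmeticFunction ℤ) n := by
  rcases eq_or_ne n 0 with rfl | hn
  · simp
  · rw [moebiusTrunc_apply, ArithmeticFunction.natCoe_apply, ArithmeticFunction.zeta_apply_ne hn]
    split_ifs
    · simpa using ArithmeticFunction.abs_moebius_le_one
    · simp

lemma abs_zeta_le (n : ℕ) : |(ζ : ArithmeticFunction ℤ) n| ≤ (ζ : ArithmeticFunction ℤ) n := by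
  rw [ArithmeticFunction.natCoe_apply, abs_of_nonneg (by positivity)]

/-- The crude bound by `d₃`, used for convergence and for `k` far from `N²`. -/
lemma abs_mertensCoeff_le (N k : ℕ) :
    |mertensCoeff N k| ≤ ((ζ : ArithmeticFunction ℤ) * ζ * ζ) k :=
  abs_mul_apply_le (abs_mul_apply_le (abs_moebiusTrunc_le N) (abs_moebiusTrunc_le N)) abs_zeta_le k

/-- The indicator function of `n > N`. -/
def tailIndicator (N : ℕ) : ArithmeticFunction ℤ :=
  ⟨fun n => if n ≤ N then 0 else 1, by simp⟩

lemma tailIndicator_apply (N n : ℕ) : tailIndicator N n = if n ≤ N then 0 else 1 := rfl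

/-- The full sum `∑_{i ∣ j} μ(i)` vanishes, so the truncated one is minus the sum over the divisors
exceeding `N`. -/
lemma abs_moebiusTrunc_mul_zeta_le (N : ℕ) {j : ℕ} (hj : j ≠ 1) :
    |(moebiusTrunc N * (ζ : ArithmeticFunction ℤ)) j|
      ≤ (tailIndicator N * (ζ : ArithmeticFunction ℤ)) j := by
  have h0 : ∑ i ∈ j.divisors, μ i = 0 := by
    rw [← ArithmeticFunction.coe_mul_zeta_apply, ArithmeticFunction.moebius_mul_coe_zeta,
      ArithmeticFunction.one_apply_ne hj]
  rw [ArithmeticFunction.coe_mul_zeta_apply, ArithmeticFunction.coe_mul_zeta_apply]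
  have h1 : ∑ i ∈ j.divisors, moebiusTrunc N i = -∑ i ∈ j.divisors, (μ i - moebiusTrunc N i) := by
    rw [Finset.sum_sub_distrib, h0]; ring
  rw [h1, abs_neg]
  refine (Finset.abs_sum_le_sum_abs _ _).trans (Finset.sum_le_sum fun i _ => ?_)
  rw [moebiusTrunc_apply, tailIndicator_apply]
  split_ifs
  · simp
  · simpa using ArithmeticFunction.abs_moebius_le_one

/-- For `k > N`, only divisors `d` of `k` with `d < k / N` contribute. -/
lemma abs_mertensCoeff_le_of_lt {N k : ℕ} (hk : N < k) :
    |mertensCoeff N k| ≤ (tailIndicator N * ((ζ : ArithmeticFunction ℤ) * ζ)) k := by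
  -- Regrouping pairs `ζ` with one truncated Möbius factor, where there is cancellation; the other
  -- factor is estimated trivially.
  have e1 : mertensCoeff N = moebiusTrunc N * (ζ : ArithmeticFunction ℤ) * moebiusTrunc N := by
    rw [mertensCoeff, mul_right_comm]
  rw [e1, ← mul_assoc, ArithmeticFunction.mul_apply,
    ArithmeticFunction.mul_apply (f := tailIndicator N * (ζ : ArithmeticFunction ℤ))]
  refine (Finset.abs_sum_le_sum_abs _ _).trans (Finset.sum_le_sum fun p hp => ?_)
  rw [Nat.mem_divisorsAntidiagonal] at hp
  have hν : 0 ≤ (tailIndicator N * (ζ : ArithmeticFunction ℤ)) p.1 := by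
    rw [ArithmeticFunction.coe_mul_zeta_apply]
    refine Finset.sum_nonneg fun i _ => ?_
    rw [tailIndicator_apply]
    split_ifs <;> simp
  rw [abs_mul]
  by_cases hn : p.2 ≤ N
  · have hj : p.1 ≠ 1 := by
      intro h
      rw [h, one_mul] at hp
      omega
    exact mul_le_mul (abs_moebiusTrunc_mul_zeta_le N hj) (abs_moebiusTrunc_le N _) (abs_nonneg _) hν
  · rw [moebiusTrunc_apply, if_neg hn, abs_zero, mul_zero]
    exact mul_nonneg hν ((abs_nonneg _).trans (abs_moebiusTrunc_le N _))

lemma floorMatrix_apply_eq_natDiv (N m n : ℕ) :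
    ((⌊(N : ℝ) ^ 2 / ((m : ℝ) * (n : ℝ))⌋ : ℤ) : ℝ) = ((N ^ 2 / (m * n) : ℕ) : ℝ) := by
  have : (N : ℝ) ^ 2 / ((m : ℝ) * (n : ℝ)) = ((N ^ 2 : ℕ) : ℝ) / ((m * n : ℕ) : ℝ) := by push_cast; rfl
  rw [this, ← Int.natCast_floor_eq_floor (by positivity), Nat.floor_div_eq_div,
    Int.cast_natCast]

lemma quadForm_eq_sum_mertensCoeff (N : ℕ) :
    quadForm N = ∑ k ∈ Finset.Ioc 0 (N ^ 2), (mertensCoeff N k : ℝ) := by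
  have h1 : quadForm N = ∑ m ∈ Finset.Ioc 0 N, ∑ n ∈ Finset.Ioc 0 N,
      (μ m : ℝ) * (μ n : ℝ) * ((N ^ 2 / (m * n) : ℕ) : ℝ) := by
    have hr : ∀ f : ℕ → ℝ, ∑ m ∈ Finset.Ioc 0 N, f m = ∑ i : Fin N, f ((i : ℕ) + 1) := by
      intro f
      rw [Fin.sum_univ_eq_sum_range (fun i => f (i + 1)), Finset.range_eq_Ico,
        Finset.sum_Ico_add' f 0 N 1]
      exact Finset.sum_congr (by ext; simp; omega) fun _ _ => rfl
    rw [hr, quadForm, dotProduct]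
    refine Finset.sum_congr rfl fun i _ => ?_
    rw [hr, Matrix.mulVec, dotProduct, Finset.mul_sum]
    refine Finset.sum_congr rfl fun j _ => ?_
    rw [← floorMatrix_apply_eq_natDiv]
    simp only [moebiusVec, floorMatrix, Matrix.of_apply]
    ring
  have h2 : ∑ k ∈ Finset.Ioc 0 (N ^ 2), mertensCoeff N k
      = ∑ m ∈ Finset.Ioc 0 N, ∑ n ∈ Finset.Ioc 0 N, μ m * μ n * ((N ^ 2 / (m * n) : ℕ) : ℤ) := by
    rw [mertensCoeff, ArithmeticFunction.sum_Ioc_mul_zeta_eq_sum]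
    have e : ∀ k ∈ Finset.Ioc 0 (N ^ 2),
        (moebiusTrunc N * moebiusTrunc N) k * ((N ^ 2 / k : ℕ) : ℤ)
        = ∑ p ∈ k.divisorsAntidiagonal,
          moebiusTrunc N p.1 * moebiusTrunc N p.2 * ((N ^ 2 / (p.1 * p.2) : ℕ) : ℤ) := by
      intro k _
      rw [ArithmeticFunction.mul_apply, Finset.sum_mul]
      refine Finset.sum_congr rfl fun p hp => ?_
      rw [(Nat.mem_divisorsAntidiagonal.1 hp).1]
    rw [Finset.sum_congr rfl e, sum_Ioc_divisorsAntidiagonal (fun m n =>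
      moebiusTrunc N m * moebiusTrunc N n * ((N ^ 2 / (m * n) : ℕ) : ℤ)), ← Finset.sum_product']
    symm
    rw [Finset.sum_congr rfl (g := fun p : ℕ × ℕ =>
      moebiusTrunc N p.1 * moebiusTrunc N p.2 * ((N ^ 2 / (p.1 * p.2) : ℕ) : ℤ))]
    -- For `m, n ≤ N` the condition `mn ≤ N²` is automatic, so the product range is contained in the
    -- hyperbolic one; the other pairs there carry a zero coefficient.
    · refine Finset.sum_subset (fun p hp => ?_) fun p hp hp' => ?_
      · simp only [Finset.mem_product, Finset.mem_Ioc, Finset.mem_filter] at hp ⊢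
        have : N ≤ N ^ 2 := Nat.le_self_pow two_ne_zero N
        exact ⟨⟨⟨hp.1.1, hp.1.2.trans this⟩, hp.2.1, hp.2.2.trans this⟩, by
          rw [sq]; exact Nat.mul_le_mul hp.1.2 hp.2.2⟩
      · simp only [Finset.mem_product, Finset.mem_Ioc, Finset.mem_filter] at hp hp'
        have : ¬ p.1 ≤ N ∨ ¬ p.2 ≤ N := by
          by_contra h
          push Not at h
          exact hp' ⟨⟨hp.1.1.1, h.1⟩, hp.1.2.1, h.2⟩
        rcases this with h | h <;> simp [moebiusTrunc_apply, h]
    · intro p hp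
      simp only [Finset.mem_product, Finset.mem_Ioc] at hp
      rw [moebiusTrunc_apply, moebiusTrunc_apply, if_pos hp.1.2, if_pos hp.2.2]
  rw [h1, ← Int.cast_sum, h2]
  push_cast
  rfl

lemma sum_inv_le (D : ℕ) : ∑ d ∈ Finset.Ioc 0 D, (d : ℝ)⁻¹ ≤ 1 + Real.log D := by
  have h1 := harmonic_le_one_add_log D
  rw [harmonic_eq_sum_Icc] at h1
  push_cast at h1
  exact h1

lemma sum_card_divisors_div_le (D : ℕ) :
    ∑ d ∈ Finset.Ioc 0 D, ((((ζ : ArithmeticFunction ℤ) * ζ) d : ℤ) : ℝ) / d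
      ≤ (1 + Real.log D) ^ 2 := by
  have e : ∀ d ∈ Finset.Ioc 0 D, ((((ζ : ArithmeticFunction ℤ) * ζ) d : ℤ) : ℝ) / d
      = ∑ p ∈ d.divisorsAntidiagonal, (p.1 : ℝ)⁻¹ * (p.2 : ℝ)⁻¹ := by
    intro d _
    rw [ArithmeticFunction.mul_apply, Int.cast_sum, Finset.sum_div]
    refine Finset.sum_congr rfl fun p hp => ?_
    have hp := Nat.mem_divisorsAntidiagonal.1 hp
    have h1 : p.1 ≠ 0 := by rintro h; simp [h] at hp; omega
    have h2 : p.2 ≠ 0 := by rintro h; simp [h] at hp; omega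
    rw [ArithmeticFunction.natCoe_apply, ArithmeticFunction.natCoe_apply,
      ArithmeticFunction.zeta_apply_ne h1, ArithmeticFunction.zeta_apply_ne h2, ← hp.1]
    push_cast
    rw [one_div, mul_inv]
  rw [Finset.sum_congr rfl e, sum_Ioc_divisorsAntidiagonal (fun m n => (m : ℝ)⁻¹ * (n : ℝ)⁻¹)]
  refine (Finset.sum_le_sum_of_subset_of_nonneg (Finset.filter_subset _ _)
    fun _ _ _ => by positivity).trans ?_
  rw [Finset.sum_product' (f := fun m n : ℕ => (m : ℝ)⁻¹ * (n : ℝ)⁻¹), ← Finset.sum_mul_sum, ← sq]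
  exact pow_le_pow_left₀ (Finset.sum_nonneg fun _ _ => by positivity) (sum_inv_le D) 2

lemma sum_one_div_one_add_le {β : ℝ} (hβ : 0 < β) (M : ℕ) :
    ∑ i ∈ Finset.range (M + 1), 1 / (1 + β * i) ≤ 1 + (1 + Real.log M) / β := by
  rw [Finset.sum_range_succ', Finset.range_eq_Ico,
    Finset.sum_Ico_add' (fun i : ℕ => 1 / (1 + β * (i : ℝ))) 0 M 1]
  have h : ∑ i ∈ Finset.Ico (0 + 1) (M + 1), 1 / (1 + β * (i : ℝ))
      ≤ ∑ i ∈ Finset.Ioc 0 M, (i : ℝ)⁻¹ / β := by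
    rw [show Finset.Ico (0 + 1) (M + 1) = Finset.Ioc 0 M by ext; simp; omega]
    refine Finset.sum_le_sum fun i hi => ?_
    have hi0 : (0 : ℝ) < i := by exact_mod_cast (Finset.mem_Ioc.1 hi).1
    rw [← one_div, div_div]
    exact one_div_le_one_div_of_le (by positivity) (by nlinarith)
  rw [← Finset.sum_div] at h
  have h2 := div_le_div_of_nonneg_right (sum_inv_le M) hβ.le
  simp only [Nat.cast_zero, mul_zero, add_zero, div_one]
  linarith

/-- Split at `⌊ρ⌋`, capped at `M` because `ρ` may lie beyond the range. On each side the distances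
to `ρ` are at least `0, 1, 2, …`, whence the factor `2`. -/
lemma sum_one_div_one_add_abs_le {β ρ : ℝ} (hβ : 0 < β) (hρ : 0 ≤ ρ) (M : ℕ) :
    ∑ m ∈ Finset.range (M + 1), 1 / (1 + β * |ρ - m|) ≤ 2 * (1 + (1 + Real.log M) / β) := by
  set g : ℕ → ℝ := fun i => 1 / (1 + β * i) with hg
  set r := min ⌊ρ⌋₊ M with hr
  have hrM : r ≤ M := min_le_right _ _
  have hlow : ∀ m ∈ Finset.range (r + 1), 1 / (1 + β * |ρ - m|) ≤ g (r + 1 - 1 - m) := by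
    intro m hm
    have hmr : m ≤ r := by simpa [Nat.lt_succ_iff] using hm
    have h1 : (r : ℝ) ≤ ρ := (Nat.le_floor_iff hρ).1 (min_le_left _ _)
    refine one_div_le_one_div_of_le (by positivity) ?_
    gcongr
    rw [Nat.add_sub_cancel, Nat.cast_sub hmr]
    exact le_trans (by linarith) (le_abs_self _)
  have hhigh : ∀ m ∈ Finset.Ico (r + 1) (M + 1), 1 / (1 + β * |ρ - m|) ≤ g (m - (r + 1)) := by
    intro m hm
    rw [Finset.mem_Ico] at hm
    have hrf : r = ⌊ρ⌋₊ := by omega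
    have h1 : ρ < r + 1 := by rw [hrf]; exact Nat.lt_floor_add_one ρ
    refine one_div_le_one_div_of_le (by positivity) ?_
    gcongr
    rw [Nat.cast_sub hm.1, abs_sub_comm]
    push_cast
    exact le_trans (by linarith) (le_abs_self _)
  have hg0 : ∀ i, 0 ≤ g i := fun i => by positivity
  have hsub : ∀ K, K ≤ M + 1 → ∑ i ∈ Finset.range K, g i ≤ 1 + (1 + Real.log M) / β := by
    intro K hK
    refine (Finset.sum_le_sum_of_subset_of_nonneg ?_ fun i _ _ => hg0 i).trans
      (sum_one_div_one_add_le hβ M)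
    intro i hi
    simp only [Finset.mem_range] at hi ⊢
    omega
  rw [← Finset.sum_range_add_sum_Ico _ (show r + 1 ≤ M + 1 by omega), two_mul]
  refine add_le_add ((Finset.sum_le_sum hlow).trans ?_) ((Finset.sum_le_sum hhigh).trans ?_)
  · rw [Finset.sum_range_reflect]
    exact hsub _ (by omega)
  · rw [Finset.sum_Ico_eq_sum_range]
    simp only [Nat.add_sub_cancel_left]
    exact hsub _ (by omega)

/-- The coefficients near `N²`, weighted by the Perron kernel. -/
theorem sum_abs_mertensCoeff_near_le {N : ℕ} (hN : 1 ≤ N) {T : ℝ} (hT : 0 < T)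
    (hTN : T ≤ 2 * N) :
    ∑ k ∈ Finset.Ioc N (2 * N ^ 2), (|mertensCoeff N k| : ℝ) *
        (1 / (1 + T * (|(N : ℝ) ^ 2 - k| / (2 * N ^ 2))))
      ≤ 12 * (1 + Real.log (2 * N)) ^ 2 * (1 + Real.log (2 * N ^ 2)) * (N ^ 2 / T) := by
  set w : ℕ → ℝ := fun k => 1 / (1 + T * (|(N : ℝ) ^ 2 - k| / (2 * N ^ 2))) with hw
  have hw0 : ∀ k, 0 ≤ w k := fun k => by positivity
  set τ : ℕ → ℝ := fun d => ((((ζ : ArithmeticFunction ℤ) * ζ) d : ℤ) : ℝ) with hτ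
  have hτ0 : ∀ d, 0 ≤ τ d := fun d => by
    refine Int.cast_nonneg ?_
    exact (abs_nonneg _).trans (abs_mul_apply_le abs_zeta_le abs_zeta_le d)
  have hN0 : (0 : ℝ) < N := by exact_mod_cast hN
  have hN1 : (1 : ℝ) ≤ N := by exact_mod_cast hN
  have hlog2 : 0 ≤ Real.log (2 * N ^ 2) := Real.log_nonneg (by nlinarith)
  have hlog1 : 0 ≤ Real.log (2 * N) := Real.log_nonneg (by linarith)
  have step1 : ∑ k ∈ Finset.Ioc N (2 * N ^ 2), (|mertensCoeff N k| : ℝ) * w k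
      ≤ ∑ k ∈ Finset.Ioc 0 (2 * N ^ 2), ∑ p ∈ k.divisorsAntidiagonal,
        (tailIndicator N p.1 : ℝ) * τ p.2 * w (p.1 * p.2) := by
    have hnn : ∀ k : ℕ, 0 ≤ ∑ p ∈ k.divisorsAntidiagonal,
        (tailIndicator N p.1 : ℝ) * τ p.2 * w (p.1 * p.2) := fun k =>
      Finset.sum_nonneg fun p _ => mul_nonneg (mul_nonneg (by
        rw [tailIndicator_apply]; split_ifs <;> simp) (hτ0 _)) (hw0 _)
    refine le_trans (Finset.sum_le_sum fun k hk => ?_)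
      (Finset.sum_le_sum_of_subset_of_nonneg
        (Finset.Ioc_subset_Ioc_left (Nat.zero_le N)) fun k _ _ => hnn k)
    have h1 := abs_mertensCoeff_le_of_lt (Finset.mem_Ioc.1 hk).1
    have h2 : (|mertensCoeff N k| : ℝ)
        ≤ (((tailIndicator N * ((ζ : ArithmeticFunction ℤ) * ζ)) k : ℤ) : ℝ) := by
      exact_mod_cast h1
    refine (mul_le_mul_of_nonneg_right h2 (hw0 k)).trans_eq ?_
    rw [ArithmeticFunction.mul_apply, Int.cast_sum, Finset.sum_mul]
    refine Finset.sum_congr rfl fun p hp => ?_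
    rw [(Nat.mem_divisorsAntidiagonal.1 hp).1, Int.cast_mul]
  -- For fixed `d` the points `md` form a progression; dividing by `d` gives distances from `ρ =
  -- N²/d` with weight `β = T d / (2N²)`.
  have inner : ∀ d ∈ Finset.Ioc 0 (2 * N), ∑ m ∈ Finset.range (2 * N ^ 2 + 1), w (m * d)
      ≤ (12 * (1 + Real.log (2 * N ^ 2)) * (N ^ 2 / T)) / d := by
    intro d hd
    rw [Finset.mem_Ioc] at hd
    have hd0 : (0 : ℝ) < d := by exact_mod_cast hd.1
    have hd2 : (d : ℝ) ≤ 2 * N := by exact_mod_cast hd.2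
    have e : ∀ m ∈ Finset.range (2 * N ^ 2 + 1), w (m * d)
        = 1 / (1 + (T * d / (2 * N ^ 2)) * |(N : ℝ) ^ 2 / d - m|) := by
      intro m _
      have h1 : (N : ℝ) ^ 2 - ((m * d : ℕ) : ℝ) = d * ((N : ℝ) ^ 2 / d - m) := by
        push_cast; field_simp
      rw [hw]
      simp only
      rw [h1, abs_mul, abs_of_pos hd0]
      congr 2
      ring
    rw [Finset.sum_congr rfl e]
    refine (sum_one_div_one_add_abs_le (by positivity) (by positivity) _).trans ?_
    push_cast
    rw [le_div_iff₀ hd0]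
    have e2 : 2 * (1 + (1 + Real.log (2 * (N : ℝ) ^ 2)) / (T * d / (2 * N ^ 2))) * d
        = 2 * d + 4 * (1 + Real.log (2 * (N : ℝ) ^ 2)) * (N ^ 2 / T) := by field_simp; ring
    rw [e2]
    -- The term nearest to `N²` contributes `2d ≤ 4N`, and `T ≤ 2N` is what allows it to be absorbed
    -- in `N²/T`; the total is `8 + 4 = 12`.
    have h3 : (N : ℝ) ≤ 2 * (N ^ 2 / T) := by
      rw [mul_div_assoc', le_div_iff₀ hT]; nlinarith
    have h4 : (N : ℝ) ^ 2 / T ≤ (1 + Real.log (2 * N ^ 2)) * (N ^ 2 / T) :=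
      le_mul_of_one_le_left (by positivity) (by linarith)
    nlinarith
  -- From `m > N` and `md ≤ 2N²` follows `d ≤ 2N`, the range on which `inner` holds.
  have step2 : ∑ k ∈ Finset.Ioc 0 (2 * N ^ 2), ∑ p ∈ k.divisorsAntidiagonal,
        (tailIndicator N p.1 : ℝ) * τ p.2 * w (p.1 * p.2)
      ≤ ∑ p ∈ Finset.range (2 * N ^ 2 + 1) ×ˢ Finset.Ioc 0 (2 * N), τ p.2 * w (p.1 * p.2) := by
    rw [sum_Ioc_divisorsAntidiagonal (fun m d => (tailIndicator N m : ℝ) * τ d * w (m * d))]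
    rw [← Finset.sum_filter_of_ne (p := fun p : ℕ × ℕ => N < p.1)]
    · refine le_trans (Finset.sum_le_sum (g := fun p : ℕ × ℕ => τ p.2 * w (p.1 * p.2))
        fun p hp => ?_) (Finset.sum_le_sum_of_subset_of_nonneg ?_
          fun p _ _ => mul_nonneg (hτ0 _) (hw0 _))
      · have := (Finset.mem_filter.1 hp).2
        rw [tailIndicator_apply, if_neg (by omega)]
        simp
      · intro p hp
        simp only [Finset.mem_filter, Finset.mem_product, Finset.mem_Ioc, Finset.mem_range] at hp ⊢
        obtain ⟨⟨⟨⟨h1, h2⟩, h3, h4⟩, h5⟩, h6⟩ := hp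
        refine ⟨by omega, h3, ?_⟩
        by_contra hcon
        push Not at hcon
        nlinarith
    · intro p _ hp
      by_contra hcon
      apply hp
      rw [tailIndicator_apply, if_pos (by omega)]
      simp
  refine (step1.trans step2).trans ?_
  rw [Finset.sum_product_right' (f := fun m d => τ d * w (m * d))]
  calc _ ≤ ∑ d ∈ Finset.Ioc 0 (2 * N), τ d *
          ((12 * (1 + Real.log (2 * N ^ 2)) * (N ^ 2 / T)) / d) := by
        refine Finset.sum_le_sum fun d hd => ?_
        rw [← Finset.mul_sum]
        exact mul_le_mul_of_nonneg_left (inner d hd) (hτ0 d)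
    _ = (∑ d ∈ Finset.Ioc 0 (2 * N), τ d / d) * (12 * (1 + Real.log (2 * N ^ 2)) * (N ^ 2 / T)) := by
        rw [Finset.sum_mul]
        exact Finset.sum_congr rfl fun d _ => by ring
    _ ≤ (1 + Real.log (2 * N)) ^ 2 * (12 * (1 + Real.log (2 * N ^ 2)) * (N ^ 2 / T)) := by
        have := sum_card_divisors_div_le (2 * N)
        push_cast at this
        gcongr
    _ = _ := by ring

/-! ### Perron's formula for the quadratic form -/

/-- The function `N^{2s} ζ(s) M(s, N)² / s` integrated in Perron's formula. -/
noncomputable def perronFun (N : ℕ) (s : ℂ) : ℂ :=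
  (N : ℂ) ^ (2 * s) * (riemannZeta s * mertensSum s N ^ 2) / s

lemma LSeriesHasSum_moebiusTrunc (N : ℕ) (s : ℂ) :
    LSeriesHasSum (fun n => (moebiusTrunc N : ArithmeticFunction ℂ) n) s (mertensSum s N) := by
  have h : mertensSum s N = ∑ n ∈ Finset.Icc 1 N,
      LSeries.term (fun n => (moebiusTrunc N : ArithmeticFunction ℂ) n) s n := by
    rw [mertensSum, Nat.floor_natCast]
    refine Finset.sum_congr rfl fun n hn => ?_
    rw [Finset.mem_Icc] at hn
    rw [LSeries.term_def, if_neg (by omega), ArithmeticFunction.intCoe_apply, moebiusTrunc_apply,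
      if_pos hn.2, Complex.cpow_neg, div_eq_mul_inv]
  rw [h]
  refine hasSum_sum_of_ne_finset_zero fun n hn => ?_
  rw [LSeries.term_def, ArithmeticFunction.intCoe_apply, moebiusTrunc_apply]
  simp only [Finset.mem_Icc, not_and_or, not_le] at hn
  rcases hn with hn | hn
  · rw [if_pos (by omega)]
  · rw [if_neg (by omega), if_neg (by omega), Int.cast_zero, zero_div]

lemma LSeriesHasSum_mertensCoeff (N : ℕ) {s : ℂ} (hs : 1 < s.re) :
    LSeriesHasSum (fun n => (mertensCoeff N n : ℂ)) s (riemannZeta s * mertensSum s N ^ 2) := by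
  have hM := LSeriesHasSum_moebiusTrunc N s
  have hz : LSeriesHasSum (fun n => (ζ : ArithmeticFunction ℂ) n) s (riemannZeta s) := by
    simpa only [ArithmeticFunction.natCoe_apply] using ArithmeticFunction.LSeriesHasSum_zeta hs
  have h := ArithmeticFunction.LSeriesHasSum_mul (ArithmeticFunction.LSeriesHasSum_mul hM hM) hz
  rw [show mertensSum s N * mertensSum s N * riemannZeta s
    = riemannZeta s * mertensSum s N ^ 2 by ring] at h
  have e : (moebiusTrunc N : ArithmeticFunction ℂ) * (moebiusTrunc N : ArithmeticFunction ℂ)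
      * (ζ : ArithmeticFunction ℂ) = (mertensCoeff N : ArithmeticFunction ℂ) := by
    rw [mertensCoeff, ArithmeticFunction.intCoe_mul, ArithmeticFunction.intCoe_mul,
      ArithmeticFunction.coe_coe]
  rw [e] at h
  simpa only [ArithmeticFunction.intCoe_apply] using h

lemma norm_riemannZeta_le {c : ℝ} (hc : 1 < c) : ‖riemannZeta c‖ ≤ 2 + 1 / (c - 1) := by
  have hc0 : 0 < c := by linarith
  have hc1 : (c : ℂ) ≠ 1 := by exact_mod_cast hc.ne'
  rw [riemannZeta_eq_zetaApprox le_rfl (by simpa using hc0) hc1, zetaApprox_one]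
  have h1 : ‖(c : ℂ) * fractTail 0 c‖ ≤ 1 := by
    have := norm_fractTail_le 0 (s := c) (by simpa using hc0)
    rw [norm_mul, Complex.norm_real, Real.norm_of_nonneg hc0.le]
    simp only [mul_zero, Real.exp_zero, Complex.ofReal_re] at this
    calc c * ‖fractTail 0 c‖ ≤ c * (1 / c) := by gcongr
      _ = 1 := by field_simp
  have h2 : ‖(1 : ℂ) / (c - 1)‖ = 1 / (c - 1) := by
    rw [norm_div, norm_one, ← Complex.ofReal_one, ← Complex.ofReal_sub, Complex.norm_real,
      Real.norm_of_nonneg (by linarith)]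
  calc _ ≤ ‖(1 : ℂ)‖ + ‖(1 : ℂ) / (c - 1)‖ + ‖(c : ℂ) * fractTail 0 c‖ :=
        (norm_sub_le _ _).trans (add_le_add (norm_add_le _ _) le_rfl)
    _ ≤ 1 + 1 / (c - 1) + 1 := by rw [norm_one, h2]; gcongr
    _ = _ := by ring

/-- The sum is `ζ(c)³`; at `c = 1 + 1/log N` the bound is `(2 + log N)³`, one source of the cubed
logarithm. -/
lemma exists_hasSum_divisor_three {c : ℝ} (hc : 1 < c) :
    ∃ S : ℝ, S ≤ (2 + 1 / (c - 1)) ^ 3 ∧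
      HasSum (fun k : ℕ => ((((ζ : ArithmeticFunction ℤ) * ζ * ζ) k : ℤ) : ℝ) / (k : ℝ) ^ c) S := by
  have hs : 1 < (c : ℂ).re := by simpa using hc
  have hz : LSeriesHasSum (fun n => (ζ : ArithmeticFunction ℂ) n) c (riemannZeta c) := by
    simpa only [ArithmeticFunction.natCoe_apply] using ArithmeticFunction.LSeriesHasSum_zeta hs
  have h := ArithmeticFunction.LSeriesHasSum_mul (ArithmeticFunction.LSeriesHasSum_mul hz hz) hz
  have e : (ζ : ArithmeticFunction ℂ) * ζ * ζ
      = (((ζ : ArithmeticFunction ℤ) * ζ * ζ : ArithmeticFunction ℤ) : ArithmeticFunction ℂ) := by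
    rw [ArithmeticFunction.intCoe_mul, ArithmeticFunction.intCoe_mul, ArithmeticFunction.coe_coe]
  rw [e] at h
  refine ⟨_, ?_, (congrArg (HasSum · _) (funext fun k => ?_)).mpr (Complex.hasSum_re h)⟩
  · refine (Complex.re_le_norm _).trans ?_
    rw [norm_mul, norm_mul, ← pow_three']
    exact pow_le_pow_left₀ (norm_nonneg _) (norm_riemannZeta_le hc) 3
  · rw [LSeries.term_def]
    rcases eq_or_ne k 0 with rfl | hk
    · simp
    · rw [if_neg hk, ArithmeticFunction.intCoe_apply, ← Complex.ofReal_natCast k,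
        ← Complex.ofReal_cpow (Nat.cast_nonneg k), ← Complex.ofReal_intCast, ← Complex.ofReal_div,
        Complex.ofReal_re]

lemma cexp_mul_log_div {N k : ℕ} (hN : N ≠ 0) (hk : k ≠ 0) (s : ℂ) :
    Complex.exp (s * (Real.log ((N : ℝ) ^ 2 / k) : ℝ)) = (N : ℂ) ^ (2 * s) / (k : ℂ) ^ s := by
  have hN' : (N : ℝ) ≠ 0 := by exact_mod_cast hN
  have hk' : (k : ℝ) ≠ 0 := by exact_mod_cast hk
  rw [Real.log_div (pow_ne_zero 2 hN') hk', Real.log_pow,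
    Complex.cpow_def_of_ne_zero (by exact_mod_cast hN),
    Complex.cpow_def_of_ne_zero (by exact_mod_cast hk), ← Complex.exp_sub]
  push_cast
  ring_nf

lemma exp_mul_log_div {N k : ℕ} (hN : N ≠ 0) (hk : k ≠ 0) (c : ℝ) :
    Real.exp (c * Real.log ((N : ℝ) ^ 2 / k)) = (N : ℝ) ^ (2 * c) / (k : ℝ) ^ c := by
  have hN' : (0 : ℝ) < N := by exact_mod_cast Nat.pos_of_ne_zero hN
  have hk' : (0 : ℝ) < k := by exact_mod_cast Nat.pos_of_ne_zero hk
  rw [mul_comm, ← Real.rpow_def_of_pos (by positivity), Real.div_rpow (by positivity) hk'.le,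
    ← Real.rpow_natCast, ← Real.rpow_mul hN'.le]
  norm_num

lemma hasSum_integral_perronFun {N : ℕ} (hN : N ≠ 0) {c : ℝ} (hc : 1 < c) (T : ℝ) :
    HasSum (fun k : ℕ => (mertensCoeff N k : ℂ) * ∫ t in (-T)..T,
        Complex.exp ((c + Complex.I * t) * (Real.log ((N : ℝ) ^ 2 / k) : ℝ)) / (c + Complex.I * t))
      (∫ t in (-T)..T, perronFun N (c + Complex.I * t)) := by
  have hc0 : 0 < c := by linarith
  obtain ⟨S, -, hS⟩ := exists_hasSum_divisor_three hc
  set D : ℕ → ℝ := fun k => ((((ζ : ArithmeticFunction ℤ) * ζ * ζ) k : ℤ) : ℝ) / (k : ℝ) ^ c with hD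
  simp_rw [← intervalIntegral.integral_const_mul]
  have hbs : Summable fun k => (N : ℝ) ^ (2 * c) * D k := hS.summable.mul_left _
  refine intervalIntegral.hasSum_integral_of_dominated_convergence
    (fun k _ => (N : ℝ) ^ (2 * c) * D k) (fun k => ?_) (fun k => ae_of_all _ fun t _ => ?_)
    (ae_of_all _ fun t _ => hbs) intervalIntegrable_const (ae_of_all _ fun t _ => ?_)
  · exact Measurable.aestronglyMeasurable (by fun_prop)
  · rcases eq_or_ne k 0 with rfl | hk
    · simp [hD]
    have hn : 1 ≤ ‖(c + Complex.I * t : ℂ)‖ := by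
      have := Complex.abs_re_le_norm (c + Complex.I * t : ℂ)
      simp only [Complex.add_re, Complex.ofReal_re, Complex.mul_re, Complex.I_re, zero_mul,
        Complex.I_im, Complex.ofReal_im, mul_zero, sub_self, add_zero, abs_of_pos hc0] at this
      linarith
    have ha : ‖(mertensCoeff N k : ℂ)‖
        ≤ ((((ζ : ArithmeticFunction ℤ) * ζ * ζ) k : ℤ) : ℝ) := by
      rw [Complex.norm_intCast, ← Int.cast_abs]
      exact Int.cast_le.2 (abs_mertensCoeff_le N k)
    have he : ‖Complex.exp ((c + Complex.I * t) * (Real.log ((N : ℝ) ^ 2 / k) : ℝ))‖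
        = (N : ℝ) ^ (2 * c) / (k : ℝ) ^ c := by
      rw [← exp_mul_log_div hN hk, Complex.norm_exp]
      simp
    rw [norm_mul, norm_div, he]
    have hpos : 0 ≤ (N : ℝ) ^ (2 * c) / (k : ℝ) ^ c := by positivity
    calc _ ≤ ((((ζ : ArithmeticFunction ℤ) * ζ * ζ) k : ℤ) : ℝ)
          * ((N : ℝ) ^ (2 * c) / (k : ℝ) ^ c) :=
          mul_le_mul ha (div_le_self hpos hn) (div_nonneg hpos (norm_nonneg _))
            ((norm_nonneg _).trans ha)
      _ = _ := by rw [hD]; ring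
  · have h := LSeriesHasSum_mertensCoeff N (s := c + Complex.I * t) (by simpa using hc)
    have h2 := HasSum.mul_left ((N : ℂ) ^ (2 * (c + Complex.I * t : ℂ)) / (c + Complex.I * t)) h
    have e : perronFun N (c + Complex.I * t) = (N : ℂ) ^ (2 * (c + Complex.I * t : ℂ))
        / (c + Complex.I * t) * (riemannZeta (c + Complex.I * t)
          * mertensSum (c + Complex.I * t) N ^ 2) := by
      rw [perronFun]; ring
    rw [e]
    refine (congrArg (HasSum · _) (funext fun k => ?_)).mpr h2
    rw [LSeries.term_def]
    rcases eq_or_ne k 0 with rfl | hk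
    · simp
    · rw [if_neg hk, cexp_mul_log_div hN hk]
      ring

/-- The indicator gives weight `1` to `k = N²`, as the inclusive partial sum demands; this matches
the value at `L = 0` in `norm_perron_sub_le`. -/
lemma hasSum_indicator_mertensCoeff (N : ℕ) (hN : N ≠ 0) :
    HasSum (fun k : ℕ => (mertensCoeff N k : ℂ) *
      (if 0 ≤ Real.log ((N : ℝ) ^ 2 / k) then 1 else 0)) (quadForm N : ℂ) := by
  have hN' : (0 : ℝ) < N := by exact_mod_cast Nat.pos_of_ne_zero hN
  have h : (quadForm N : ℂ) = ∑ k ∈ Finset.Ioc 0 (N ^ 2), (mertensCoeff N k : ℂ) *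
      (if 0 ≤ Real.log ((N : ℝ) ^ 2 / k) then 1 else 0) := by
    rw [quadForm_eq_sum_mertensCoeff]
    push_cast
    refine Finset.sum_congr rfl fun k hk => ?_
    rw [Finset.mem_Ioc] at hk
    have hk0 : (0 : ℝ) < k := by exact_mod_cast hk.1
    have hk1 : (k : ℝ) ≤ (N : ℝ) ^ 2 := by exact_mod_cast hk.2
    rw [if_pos (Real.log_nonneg ((one_le_div hk0).2 hk1)), mul_one]
  rw [h]
  refine hasSum_sum_of_ne_finset_zero fun k hk => ?_
  rcases eq_or_ne k 0 with rfl | hk0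
  · simp
  · have hk1 : N ^ 2 < k := by
      by_contra hcon
      exact hk (Finset.mem_Ioc.2 ⟨Nat.pos_of_ne_zero hk0, not_lt.1 hcon⟩)
    have hk2 : (N : ℝ) ^ 2 < k := by exact_mod_cast hk1
    have hk3 : (0 : ℝ) < k := by exact_mod_cast Nat.pos_of_ne_zero hk0
    rw [if_neg (not_le.2 (Real.log_neg (by positivity) ((div_lt_one hk3).2 hk2))), mul_zero]

lemma abs_sub_div_le_abs_log {x k : ℝ} (hk : 0 < k) (hx : 0 < x) (hkx : k ≤ 2 * x) :
    |x - k| / (2 * x) ≤ |Real.log (x / k)| := by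
  rcases le_total k x with h | h
  · have h1 := Real.one_sub_inv_le_log_of_pos (x := x / k) (by positivity)
    rw [abs_of_nonneg (by linarith)]
    refine le_trans ?_ (h1.trans (le_abs_self _))
    rw [inv_div, div_le_iff₀ (by positivity)]
    have : (1 - k / x) * (2 * x) = 2 * (x - k) := by field_simp
    rw [this]; linarith
  · have h1 := Real.one_sub_inv_le_log_of_pos (x := k / x) (by positivity)
    rw [abs_sub_comm, abs_of_nonneg (by linarith), ← abs_neg, ← Real.log_inv, inv_div]
    refine le_trans ?_ (h1.trans (le_abs_self _))
    rw [inv_div, div_le_iff₀ (by positivity)]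
    have : (1 - x / k) * (2 * x) = (k - x) * (2 * x / k) := by field_simp
    rw [this]
    exact le_mul_of_one_le_right (by linarith) ((one_le_div hk).2 hkx)

lemma half_le_abs_log {x k : ℝ} (hk : 0 < k) (hx : 0 < x) (h : k < x / 2 ∨ 2 * x < k) :
    1 / 2 ≤ |Real.log (x / k)| := by
  have h2 := Real.log_two_gt_d9
  rcases h with h | h
  · have : Real.log 2 ≤ Real.log (x / k) :=
      Real.log_le_log two_pos (by rw [le_div_iff₀ hk]; linarith)
    exact le_trans (by linarith) (le_abs_self _)
  · have : Real.log 2 ≤ Real.log (k / x) :=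
      Real.log_le_log two_pos (by rw [le_div_iff₀ hx]; linarith)
    rw [← abs_neg, ← Real.log_inv, inv_div]
    exact le_trans (by linarith) (le_abs_self _)

/-- Perron's formula for `mᵀ A m` on the line `Re s = 1 + 1 / log N`. -/
theorem norm_quadForm_sub_integral_le {N : ℕ} (hN : 3 ≤ N) {T : ℝ} (hT : 0 < T) (hTN : T ≤ 2 * N) :
    ‖(quadForm N : ℂ) - (2 * Real.pi : ℂ)⁻¹ *
        ∫ t in (-T)..T, perronFun N ((1 + 1 / Real.log N : ℝ) + Complex.I * t)‖
      ≤ 17280 * Real.log N ^ 3 * (N ^ 2 / T) := by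
  have hN0 : N ≠ 0 := by omega
  have hN3 : (3 : ℝ) ≤ N := by exact_mod_cast hN
  have hNpos : (0 : ℝ) < N := by linarith
  have hℓ : 1 ≤ Real.log N := by
    rw [Real.le_log_iff_exp_le hNpos]
    linarith [Real.exp_one_lt_d9]
  set ℓ := Real.log N with hℓdef
  set c : ℝ := 1 + 1 / ℓ with hcdef
  have hinv : 0 < 1 / ℓ := by positivity
  have hinv1 : 1 / ℓ ≤ 1 := by rw [div_le_one (by linarith)]; exact hℓ
  have hc : 1 < c := by rw [hcdef]; linarith
  have hc2 : c ≤ 2 := by rw [hcdef]; linarith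
  have hc0 : 0 < c := by linarith
  obtain ⟨S, hSle, hS⟩ := exists_hasSum_divisor_three hc
  set D : ℕ → ℝ := fun k => ((((ζ : ArithmeticFunction ℤ) * ζ * ζ) k : ℤ) : ℝ) / (k : ℝ) ^ c with hD
  have hD0 : ∀ k, 0 ≤ D k := fun k => div_nonneg
    (Int.cast_nonneg ((abs_nonneg _).trans (abs_mertensCoeff_le N k))) (by positivity)
  set w : ℕ → ℝ := fun k => (|mertensCoeff N k| : ℝ) *
    (1 / (1 + T * (|(N : ℝ) ^ 2 - k| / (2 * N ^ 2)))) with hw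
  have hw0 : ∀ k, 0 ≤ w k := fun k => by positivity
  set B : ℕ → ℝ := fun k => if k ∈ Finset.Ioc N (2 * N ^ 2) then 32 * w k else 0 with hB
  have hBsum : HasSum B (32 * ∑ k ∈ Finset.Ioc N (2 * N ^ 2), w k) := by
    have h : 32 * ∑ k ∈ Finset.Ioc N (2 * N ^ 2), w k = ∑ k ∈ Finset.Ioc N (2 * N ^ 2), B k := by
      rw [Finset.mul_sum]
      exact Finset.sum_congr rfl fun k hk => by rw [hB]; simp only [if_pos hk]
    rw [h]
    exact hasSum_sum_of_ne_finset_zero fun k hk => by rw [hB]; simp only [if_neg hk]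
  have hAsum := hS.mul_left (16 / T * (N : ℝ) ^ (2 * c))
  have hdiff := (hasSum_indicator_mertensCoeff N hN0).sub
    ((hasSum_integral_perronFun hN0 hc T).mul_left (2 * Real.pi : ℂ)⁻¹)
  have hterm : ∀ k : ℕ, ‖(mertensCoeff N k : ℂ) *
      (if 0 ≤ Real.log ((N : ℝ) ^ 2 / k) then 1 else 0) - (2 * Real.pi : ℂ)⁻¹ *
        ((mertensCoeff N k : ℂ) * ∫ t in (-T)..T,
        Complex.exp ((c + Complex.I * t) * (Real.log ((N : ℝ) ^ 2 / k) : ℝ)) / (c + Complex.I * t))‖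
      ≤ 16 / T * (N : ℝ) ^ (2 * c) * D k + B k := by
    intro k
    rcases eq_or_ne k 0 with rfl | hk
    · have : 0 ≤ B 0 := by simp [hB]
      simpa [hD] using this
    have hk0 : (0 : ℝ) < k := by exact_mod_cast Nat.pos_of_ne_zero hk
    have hx0 : (0 : ℝ) < (N : ℝ) ^ 2 := by positivity
    set L := Real.log ((N : ℝ) ^ 2 / k) with hL
    have hP := norm_perron_sub_le hc0 hT L
    have e : ∀ a χ J : ℂ, a * χ - (2 * Real.pi : ℂ)⁻¹ * (a * J)
        = -(a * ((2 * Real.pi : ℂ)⁻¹ * J - χ)) := fun a χ J => by ring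
    rw [e, norm_neg, norm_mul, Complex.norm_intCast]
    have hle : |(mertensCoeff N k : ℝ)| * (8 * Real.exp (c * L) / (1 + T * |L|))
        ≤ 16 / T * (N : ℝ) ^ (2 * c) * D k + B k := by
      have hB0 : 0 ≤ B k := by
        rw [hB]
        simp only
        split_ifs
        · exact mul_nonneg (by norm_num) (hw0 k)
        · exact le_rfl
      have hA0 : 0 ≤ 16 / T * (N : ℝ) ^ (2 * c) * D k := mul_nonneg (by positivity) (hD0 k)
      -- For `N²/2 ≤ k ≤ 2N²` one has `e^{cL} ≤ 4`, and the decay in `|N² - k|` is kept for the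
      -- sharp coefficient bound. Otherwise `|L| ≥ 1/2`, and the saving `1/T` is combined with
      -- `d₃(k)`.
      by_cases hnear : (N : ℝ) ^ 2 / 2 ≤ k ∧ (k : ℝ) ≤ 2 * N ^ 2
      · have hmem : k ∈ Finset.Ioc N (2 * N ^ 2) := by
          rw [Finset.mem_Ioc]
          refine ⟨?_, by exact_mod_cast hnear.2⟩
          have : (N : ℝ) < k := by nlinarith [hnear.1]
          exact_mod_cast this
        have hexp : Real.exp (c * L) ≤ 4 := by
          have h1 : L ≤ Real.log 2 :=
            Real.log_le_log (by positivity) (by rw [div_le_iff₀ hk0]; linarith [hnear.1])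
          calc Real.exp (c * L) ≤ Real.exp (2 * Real.log 2) := by
                refine Real.exp_le_exp.2 ?_
                have := Real.log_pos one_lt_two
                nlinarith
            _ = 4 := by rw [mul_comm, Real.exp_mul, Real.exp_log two_pos]; norm_num
        have hden : 1 + T * (|(N : ℝ) ^ 2 - k| / (2 * N ^ 2)) ≤ 1 + T * |L| := by
          gcongr
          exact abs_sub_div_le_abs_log hk0 hx0 hnear.2
        have : |(mertensCoeff N k : ℝ)| * (8 * Real.exp (c * L) / (1 + T * |L|)) ≤ B k := by
          rw [hB]
          simp only [if_pos hmem, hw]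
          calc _ ≤ |(mertensCoeff N k : ℝ)| *
                ((8 * 4) / (1 + T * (|(N : ℝ) ^ 2 - k| / (2 * N ^ 2)))) := by gcongr
            _ = _ := by ring
        linarith
      · have hfar : 1 / 2 ≤ |L| := by
          refine half_le_abs_log hk0 hx0 ?_
          by_contra hcon
          push Not at hcon
          exact hnear hcon
        have ha : |(mertensCoeff N k : ℝ)| ≤ ((((ζ : ArithmeticFunction ℤ) * ζ * ζ) k : ℤ) : ℝ) := by
          rw [← Int.cast_abs]
          exact Int.cast_le.2 (abs_mertensCoeff_le N k)
        have : |(mertensCoeff N k : ℝ)| * (8 * Real.exp (c * L) / (1 + T * |L|))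
            ≤ 16 / T * (N : ℝ) ^ (2 * c) * D k := by
          have hz0 := (abs_nonneg _).trans ha
          calc _ ≤ ((((ζ : ArithmeticFunction ℤ) * ζ * ζ) k : ℤ) : ℝ) *
                (8 * Real.exp (c * L) / (T * (1 / 2))) := by
                gcongr
                nlinarith
            _ = _ := by
                rw [hL, exp_mul_log_div hN0 hk, hD]
                field_simp
                ring
        linarith
    exact (mul_le_mul_of_nonneg_left hP (abs_nonneg _)).trans hle
  have hfin := hdiff.norm_le_of_bounded (hAsum.add hBsum) hterm
  refine hfin.trans ?_
  have hnear := sum_abs_mertensCoeff_near_le (show 1 ≤ N by omega) hT hTN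
  have hl2 := Real.log_two_lt_d9
  have hl2' := Real.log_two_gt_d9
  have h2N : 1 + Real.log (2 * N) ≤ 3 * ℓ := by
    rw [Real.log_mul two_ne_zero hNpos.ne', ← hℓdef]; linarith
  have h2N' : 1 + Real.log (2 * (N : ℝ) ^ 2) ≤ 4 * ℓ := by
    rw [Real.log_mul two_ne_zero (by positivity), Real.log_pow, ← hℓdef]; push_cast; linarith
  have h2N0 : 0 ≤ 1 + Real.log (2 * N) := by
    rw [Real.log_mul two_ne_zero hNpos.ne', ← hℓdef]; linarith
  have h2N0' : 0 ≤ 1 + Real.log (2 * (N : ℝ) ^ 2) := by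
    rw [Real.log_mul two_ne_zero (by positivity), Real.log_pow, ← hℓdef]; push_cast; linarith
  have hNc : (N : ℝ) ^ (2 * c) ≤ 8 * N ^ 2 := by
    have h1 : (N : ℝ) ^ (2 * c) = N ^ 2 * Real.exp 2 := by
      have h0 : 2 * c = ((2 : ℕ) : ℝ) + 2 / ℓ := by rw [hcdef]; push_cast; ring
      rw [h0, Real.rpow_add hNpos, Real.rpow_natCast, Real.rpow_def_of_pos hNpos, ← hℓdef]
      congr 2
      field_simp
    have h2 : Real.exp 2 ≤ 8 := by
      have : Real.exp 2 = Real.exp 1 * Real.exp 1 := by rw [← Real.exp_add]; norm_num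
      rw [this]
      nlinarith [Real.exp_one_lt_d9, Real.exp_pos 1]
    rw [h1]
    nlinarith [sq_nonneg (N : ℝ)]
  have hS3 : S ≤ 27 * ℓ ^ 3 := by
    refine hSle.trans ?_
    have h1 : 2 + 1 / (c - 1) ≤ 3 * ℓ := by
      rw [hcdef, add_sub_cancel_left, one_div_one_div]; linarith
    calc (2 + 1 / (c - 1)) ^ 3 ≤ (3 * ℓ) ^ 3 :=
          pow_le_pow_left₀ (add_nonneg two_pos.le (one_div_nonneg.2 (by linarith))) h1 3
      _ = _ := by ring
  have hS0 : 0 ≤ S := hS.nonneg hD0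
  -- The far terms give `16 · 8 · 27 = 3456` and the near ones `32 · 12 · 9 · 4 = 13824`; here `8`
  -- bounds `e²`, as `N^{2c} = e² N²`.
  calc 16 / T * (N : ℝ) ^ (2 * c) * S + 32 * ∑ k ∈ Finset.Ioc N (2 * N ^ 2), w k
      ≤ 16 / T * (8 * N ^ 2) * (27 * ℓ ^ 3) + 32 * (12 * (3 * ℓ) ^ 2 * (4 * ℓ) * (N ^ 2 / T)) := by
        gcongr
        refine hnear.trans ?_
        gcongr
    _ = _ := by ring

/-! ### Residue at `1` and the shift of the line -/

lemma log_neg_of_im_pos {z : ℂ} (hz : 0 < z.im) :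
    Complex.log (-z) = Complex.log z - Real.pi * Complex.I := by
  rw [Complex.log, Complex.log, norm_neg, Complex.arg_neg_eq_arg_sub_pi_of_im_pos hz]
  push_cast
  ring

lemma hasDerivAt_log_add_mul {z v : ℂ} {t : ℝ} (h : z + v * t ∈ Complex.slitPlane) :
    HasDerivAt (fun t : ℝ => Complex.log (z + v * t)) (v / (z + v * t)) t := by
  have e1 : HasDerivAt (fun t : ℝ => (t : ℂ)) 1 t := Complex.ofRealCLM.hasDerivAt
  simpa using ((e1.const_mul v).const_add z).clog_real h

lemma integral_log_add_mul {z v : ℂ} {a b : ℝ} (h : ∀ t ∈ uIcc a b, z + v * t ∈ Complex.slitPlane) :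
    ∫ t in a..b, v / (z + v * t) = Complex.log (z + v * b) - Complex.log (z + v * a) := by
  refine intervalIntegral.integral_eq_sub_of_hasDerivAt
    (f := fun t : ℝ => Complex.log (z + v * t)) (fun t ht => hasDerivAt_log_add_mul (h t ht)) ?_
  refine ContinuousOn.intervalIntegrable fun t ht => ContinuousAt.continuousWithinAt ?_
  have := Complex.slitPlane_ne_zero (h t ht)
  fun_prop (disch := assumption)

/-- The residue of `1 / (s - 1)` computed along a rectangle. -/
lemma integral_rect_inv_sub_one {a c T : ℝ} (ha : a < 1) (hc : 1 < c) (hT : 0 < T) :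
    (∫ x in a..c, ((x + (-T : ℝ) * Complex.I : ℂ) - 1)⁻¹)
      - (∫ x in a..c, ((x + T * Complex.I : ℂ) - 1)⁻¹)
      + Complex.I * (∫ y in (-T)..T, ((c + y * Complex.I : ℂ) - 1)⁻¹)
      - Complex.I * (∫ y in (-T)..T, ((a + y * Complex.I : ℂ) - 1)⁻¹) = 2 * Real.pi * Complex.I := by
  have horiz : ∀ Y : ℝ, Y ≠ 0 → ∫ x in a..c, ((x + Y * Complex.I : ℂ) - 1)⁻¹
      = Complex.log ((c - 1) + Y * Complex.I) - Complex.log ((a - 1) + Y * Complex.I) := by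
    intro Y hY
    have h := integral_log_add_mul (z := Y * Complex.I - 1) (v := 1) (a := a) (b := c)
      (fun t _ => Or.inr (by simpa using hY))
    rw [show ((c - 1) + Y * Complex.I : ℂ) = Y * Complex.I - 1 + 1 * c by ring,
      show ((a - 1) + Y * Complex.I : ℂ) = Y * Complex.I - 1 + 1 * a by ring, ← h]
    refine intervalIntegral.integral_congr fun x _ => ?_
    rw [one_div]
    congr 1
    ring
  have right : Complex.I * (∫ y in (-T)..T, ((c + y * Complex.I : ℂ) - 1)⁻¹)
      = Complex.log ((c - 1) + T * Complex.I) - Complex.log ((c - 1) + (-T : ℝ) * Complex.I) := by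
    have h := integral_log_add_mul (z := c - 1) (v := Complex.I) (a := -T) (b := T)
      (fun t _ => Or.inl (by simpa using hc))
    rw [mul_comm (T : ℂ), mul_comm ((-T : ℝ) : ℂ), ← h, ← intervalIntegral.integral_const_mul]
    refine intervalIntegral.integral_congr fun y _ => ?_
    rw [div_eq_mul_inv]
    congr 2
    ring
  -- This side crosses the branch cut of `log (s - 1)`, so the logarithm of `1 - s` is used;
  -- returning to `log (s - 1)` at the two corners yields `πi` twice.
  have left : Complex.I * (∫ y in (-T)..T, ((a + y * Complex.I : ℂ) - 1)⁻¹)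
      = Complex.log (-((a - 1) + T * Complex.I)) - Complex.log (-((a - 1) + (-T : ℝ) * Complex.I)) := by
    have h := integral_log_add_mul (z := 1 - a) (v := -Complex.I) (a := -T) (b := T)
      (fun t _ => Or.inl (by simpa using ha))
    rw [show (-((a - 1) + T * Complex.I) : ℂ) = 1 - a + -Complex.I * T by ring,
      show (-((a - 1) + (-T : ℝ) * Complex.I) : ℂ) = 1 - a + -Complex.I * (-T : ℝ) by ring,
      ← h, ← intervalIntegral.integral_const_mul]
    refine intervalIntegral.integral_congr fun y _ => ?_
    rw [show (1 - a + -Complex.I * y : ℂ) = -((a + y * Complex.I) - 1) by ring, neg_div_neg_eq,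
      div_eq_mul_inv]
  rw [horiz _ hT.ne', horiz _ (neg_ne_zero.2 hT.ne'), right, left]
  have h1 := log_neg_of_im_pos (z := (a - 1) + T * Complex.I) (by simpa using hT)
  have h2 := log_neg_of_im_pos (z := -((a - 1) + (-T : ℝ) * Complex.I)) (by simpa using hT)
  rw [neg_neg] at h2
  rw [h1, h2]
  ring

/-- `h(s)/(s-1)` is the sum of `h(1)/(s-1)` and the difference quotient `dslope h 1`, which is
holomorphic across `1` and so is annihilated by Cauchy's theorem on the rectangle. -/
lemma integral_div_sub_one_eq {h : ℂ → ℂ} {U : Set ℂ} (hU : IsOpen U) (h1 : (1 : ℂ) ∈ U)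
    (hh : DifferentiableOn ℂ h U) {γ : ℝ → ℂ} (hγ : Continuous γ) {a b : ℝ}
    (hγU : ∀ t ∈ uIcc a b, γ t ∈ U) (hγ1 : ∀ t ∈ uIcc a b, γ t ≠ 1) :
    ∫ t in a..b, h (γ t) / (γ t - 1)
      = (∫ t in a..b, dslope h 1 (γ t)) + h 1 * ∫ t in a..b, (γ t - 1)⁻¹ := by
  have hg : DifferentiableOn ℂ (dslope h 1) U :=
    (Complex.differentiableOn_dslope (hU.mem_nhds h1)).2 hh
  have i1 : IntervalIntegrable (fun t => dslope h 1 (γ t)) volume a b :=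
    (hg.continuousOn.comp hγ.continuousOn hγU).intervalIntegrable
  have i2 : IntervalIntegrable (fun t => (γ t - 1)⁻¹) volume a b :=
    (ContinuousOn.inv₀ (by fun_prop) fun t ht => sub_ne_zero.2 (hγ1 t ht)).intervalIntegrable
  rw [← intervalIntegral.integral_const_mul, ← intervalIntegral.integral_add i1 (i2.const_mul _)]
  refine intervalIntegral.integral_congr fun t ht => ?_
  have hne := sub_ne_zero.2 (hγ1 t ht)
  rw [dslope_of_ne _ (hγ1 t ht), slope_def_field]
  field_simp
  ring

/-- The residue theorem for a rectangle around a simple pole at `1`. -/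
theorem integral_rect_div_sub_one {h : ℂ → ℂ} (hh : DifferentiableOn ℂ h {s | 0 < s.re})
    {a c T : ℝ} (ha0 : 0 < a) (ha : a < 1) (hc : 1 < c) (hT : 0 < T) :
    (∫ x in a..c, h (x + (-T : ℝ) * Complex.I) / ((x + (-T : ℝ) * Complex.I : ℂ) - 1))
      - (∫ x in a..c, h (x + T * Complex.I) / ((x + T * Complex.I : ℂ) - 1))
      + Complex.I * (∫ y in (-T)..T, h (c + y * Complex.I) / ((c + y * Complex.I : ℂ) - 1))
      - Complex.I * (∫ y in (-T)..T, h (a + y * Complex.I) / ((a + y * Complex.I : ℂ) - 1))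
      = 2 * Real.pi * Complex.I * h 1 := by
  have hU : IsOpen {s : ℂ | 0 < s.re} := isOpen_lt continuous_const Complex.continuous_re
  have h1 : (1 : ℂ) ∈ {s : ℂ | 0 < s.re} := by simp
  have hac : a ≤ c := by linarith
  have horiz : ∀ Y : ℝ, Y ≠ 0 →
      ∫ x in a..c, h (x + Y * Complex.I) / ((x + Y * Complex.I : ℂ) - 1)
      = (∫ x in a..c, dslope h 1 (x + Y * Complex.I))
        + h 1 * ∫ x in a..c, ((x + Y * Complex.I : ℂ) - 1)⁻¹ := by
    intro Y hY
    refine integral_div_sub_one_eq hU h1 hh (γ := fun x : ℝ => (x + Y * Complex.I : ℂ))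
      (by fun_prop) (fun x hx => ?_) fun x hx heq => ?_
    · rw [uIcc_of_le hac] at hx
      simpa using ha0.trans_le hx.1
    · have := congrArg Complex.im heq
      simp [hY] at this
  have vert : ∀ X : ℝ, 0 < X → X ≠ 1 →
      ∫ y in (-T)..T, h (X + y * Complex.I) / ((X + y * Complex.I : ℂ) - 1)
      = (∫ y in (-T)..T, dslope h 1 (X + y * Complex.I))
        + h 1 * ∫ y in (-T)..T, ((X + y * Complex.I : ℂ) - 1)⁻¹ := by
    intro X hX hX1
    refine integral_div_sub_one_eq hU h1 hh (γ := fun y : ℝ => (X + y * Complex.I : ℂ))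
      (by fun_prop) (fun x hx => by simpa using hX) fun x hx heq => ?_
    have := congrArg Complex.re heq
    simp [hX1] at this
  have hrect := Complex.integral_boundary_rect_eq_zero_of_differentiableOn (dslope h 1)
    (⟨a, -T⟩ : ℂ) (⟨c, T⟩ : ℂ)
    (((Complex.differentiableOn_dslope (hU.mem_nhds h1)).2 hh).mono fun s hs => by
      have := (Complex.mem_reProdIm.1 hs).1
      simp only [uIcc_of_le hac] at this
      exact ha0.trans_le this.1)
  simp only [smul_eq_mul] at hrect
  rw [horiz _ hT.ne', horiz _ (neg_ne_zero.2 hT.ne'), vert c (by linarith) hc.ne', vert a ha0 ha.ne]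
  linear_combination hrect + h 1 * integral_rect_inv_sub_one ha hc hT

lemma differentiable_mertensSum (x : ℝ) : Differentiable ℂ fun s => mertensSum s x := by
  unfold mertensSum
  refine Differentiable.fun_sum fun n hn => ?_
  have hn0 : (n : ℂ) ≠ 0 := by
    have := (Finset.mem_Icc.1 hn).1
    exact_mod_cast (by omega : n ≠ 0)
  exact (differentiable_neg.const_cpow (Or.inl hn0)).const_mul _

lemma perronFun_eq_div_sub_one (N : ℕ) {s : ℂ} (hs : s ≠ 1) :
    perronFun N s = (N : ℂ) ^ (2 * s) * (riemannZeta₁ s * mertensSum s N ^ 2) / s / (s - 1) := by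
  have : s - 1 ≠ 0 := sub_ne_zero.2 hs
  rw [perronFun, riemannZeta_eq_inv_sub_mul hs]
  ring

lemma integral_perronFun_sub {N : ℕ} (hN : N ≠ 0) {c T : ℝ} (hc : 1 < c) (hT : 0 < T) :
    Complex.I * ((∫ t in (-T)..T, perronFun N (c + Complex.I * t))
        - ∫ t in (-T)..T, perronFun N (1 / 2 + Complex.I * t))
      - 2 * Real.pi * Complex.I * (N ^ 2 * mertensSum 1 N ^ 2)
      = (∫ x in (1 / 2 : ℝ)..c, perronFun N (x + Complex.I * T))
        - ∫ x in (1 / 2 : ℝ)..c, perronFun N (x + Complex.I * (-T : ℝ)) := by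
  set h : ℂ → ℂ := fun s => (N : ℂ) ^ (2 * s) * (riemannZeta₁ s * mertensSum s N ^ 2) / s with hh
  have hNc : (N : ℂ) ≠ 0 := by exact_mod_cast hN
  have hd : DifferentiableOn ℂ h {s | 0 < s.re} := by
    intro s hs
    have hs0 : s ≠ 0 := by rintro rfl; simp at hs
    have hm := differentiable_mertensSum (N : ℝ) s
    have hp : DifferentiableAt ℂ (fun s : ℂ => (N : ℂ) ^ (2 * s)) s :=
      (differentiableAt_id.const_mul 2).const_cpow (Or.inl hNc)
    refine DifferentiableAt.differentiableWithinAt ?_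
    exact (hp.mul ((differentiable_riemannZeta₁ s).mul (hm.pow 2))).div differentiableAt_id hs0
  have key := integral_rect_div_sub_one hd (a := 1 / 2) (by norm_num) (by norm_num) hc hT
  have horiz : ∀ Y : ℝ, Y ≠ 0 → ∫ x in (1 / 2 : ℝ)..c, h (x + Y * Complex.I) / ((x + Y * Complex.I : ℂ) - 1)
      = ∫ x in (1 / 2 : ℝ)..c, perronFun N (x + Complex.I * Y) := by
    intro Y hY
    refine intervalIntegral.integral_congr fun x _ => ?_
    rw [mul_comm Complex.I, perronFun_eq_div_sub_one]
    intro heq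
    have := congrArg Complex.im heq
    simp [hY] at this
  have vert : ∀ X : ℝ, X ≠ 1 → ∫ y in (-T)..T, h (X + y * Complex.I) / ((X + y * Complex.I : ℂ) - 1)
      = ∫ y in (-T)..T, perronFun N (X + Complex.I * y) := by
    intro X hX
    refine intervalIntegral.integral_congr fun y _ => ?_
    rw [mul_comm Complex.I, perronFun_eq_div_sub_one]
    intro heq
    have := congrArg Complex.re heq
    simp [hX] at this
  rw [horiz _ hT.ne', horiz _ (neg_ne_zero.2 hT.ne'), vert _ hc.ne', vert (1 / 2) (by norm_num)] at key
  have hone : h 1 = N ^ 2 * mertensSum 1 N ^ 2 := by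
    simp only [hh, riemannZeta₁_one, mul_one, one_mul, div_one]
    norm_num
  rw [hone] at key
  push_cast at key ⊢
  linear_combination key

/-! ### Horizontal sides and the choice of `T` -/

lemma norm_mertensSum_le {N : ℕ} (s : ℂ) :
    ‖mertensSum s N‖ ≤ ∑ n ∈ Finset.Ioc 0 N, (n : ℝ) ^ (-s.re) := by
  rw [mertensSum, Nat.floor_natCast]
  refine norm_sum_le_of_le _ fun n hn => ?_
  rw [norm_mul, Complex.norm_natCast_cpow_of_pos (Finset.mem_Icc.1 hn).1, Complex.neg_re]
  refine mul_le_of_le_one_left (by positivity) ?_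
  rw [Complex.norm_intCast, ← Int.cast_abs]
  exact_mod_cast ArithmeticFunction.abs_moebius_le_one

/-- Each term is `(N/n)^σ = (N/n)(N/n)^{σ-1}`, and the last factor is at most `N^{1/log N} = e < 3`.
Hence the bound is uniform in `σ`: the growth of `M` to the left is compensated by the decay of
`N^σ`. -/
lemma rpow_mul_norm_mertensSum_le {N : ℕ} (hN : 3 ≤ N) {s : ℂ}
    (hs : s.re ≤ 1 + 1 / Real.log N) :
    (N : ℝ) ^ s.re * ‖mertensSum s N‖ ≤ 6 * N * Real.log N := by
  have hN3 : (3 : ℝ) ≤ N := by exact_mod_cast hN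
  have hNpos : (0 : ℝ) < N := by linarith
  have hℓ : 1 ≤ Real.log N := by
    rw [Real.le_log_iff_exp_le hNpos]
    linarith [Real.exp_one_lt_d9]
  set ℓ := Real.log N with hℓdef
  have hterm : ∀ n ∈ Finset.Ioc 0 N, (N : ℝ) ^ s.re * (n : ℝ) ^ (-s.re) ≤ 3 * N * (n : ℝ)⁻¹ := by
    intro n hn
    rw [Finset.mem_Ioc] at hn
    have hn0 : (0 : ℝ) < n := by exact_mod_cast hn.1
    have hnN : (n : ℝ) ≤ N := by exact_mod_cast hn.2
    have e : (N : ℝ) ^ s.re * (n : ℝ) ^ (-s.re) = N * (n : ℝ)⁻¹ * ((N / n : ℝ) ^ (s.re - 1)) := by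
      rw [Real.div_rpow hNpos.le hn0.le, Real.rpow_sub_one hNpos.ne', Real.rpow_sub_one hn0.ne',
        Real.rpow_neg hn0.le]
      field_simp
    have h1 : (1 : ℝ) ≤ N / n := (one_le_div hn0).2 hnN
    have h2 : (N / n : ℝ) ^ (s.re - 1) ≤ 3 := by
      calc (N / n : ℝ) ^ (s.re - 1) ≤ (N / n : ℝ) ^ (1 / ℓ) :=
            Real.rpow_le_rpow_of_exponent_le h1 (by linarith)
        _ ≤ (N : ℝ) ^ (1 / ℓ) := by
            refine Real.rpow_le_rpow (by positivity) (div_le_self hNpos.le ?_) (by positivity)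
            exact_mod_cast hn.1
        _ = Real.exp 1 := by
            rw [Real.rpow_def_of_pos hNpos, ← hℓdef, mul_one_div_cancel (by linarith)]
        _ ≤ 3 := by linarith [Real.exp_one_lt_d9]
    rw [e]
    calc _ ≤ N * (n : ℝ)⁻¹ * 3 := by gcongr
      _ = _ := by ring
  calc _ ≤ (N : ℝ) ^ s.re * ∑ n ∈ Finset.Ioc 0 N, (n : ℝ) ^ (-s.re) := by
        gcongr; exact norm_mertensSum_le s
    _ = ∑ n ∈ Finset.Ioc 0 N, (N : ℝ) ^ s.re * (n : ℝ) ^ (-s.re) := Finset.mul_sum _ _ _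
    _ ≤ ∑ n ∈ Finset.Ioc 0 N, 3 * N * (n : ℝ)⁻¹ := Finset.sum_le_sum hterm
    _ = 3 * N * ∑ n ∈ Finset.Ioc 0 N, (n : ℝ)⁻¹ := (Finset.mul_sum _ _ _).symm
    _ ≤ 3 * N * (1 + ℓ) := by gcongr; exact sum_inv_le N
    _ ≤ _ := by nlinarith

lemma norm_perronFun_le {N : ℕ} (hN : 3 ≤ N) {s : ℂ} (hs : s.re ≤ 1 + 1 / Real.log N)
    (hs0 : s.im ≠ 0) :
    ‖perronFun N s‖ ≤ 36 * Real.log N ^ 2 * N ^ 2 / |s.im| * ‖riemannZeta s‖ := by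
  have h1 := rpow_mul_norm_mertensSum_le hN hs
  have hNpos : 0 < N := by omega
  have hN0 : (0 : ℝ) < N := by exact_mod_cast hNpos
  have e : ‖perronFun N s‖ = ((N : ℝ) ^ s.re * ‖mertensSum s N‖) ^ 2 * ‖riemannZeta s‖ / ‖s‖ := by
    rw [perronFun, norm_div, norm_mul, norm_mul, norm_pow, Complex.norm_natCast_cpow_of_pos hNpos,
      mul_pow, ← Real.rpow_natCast ((N : ℝ) ^ s.re), ← Real.rpow_mul hN0.le]
    have : (2 * s).re = s.re * ((2 : ℕ) : ℝ) := by simp; ring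
    rw [this]
    ring
  rw [e]
  have h3 : 0 < |s.im| := abs_pos.2 hs0
  calc _ ≤ (6 * N * Real.log N) ^ 2 * ‖riemannZeta s‖ / |s.im| := by
        gcongr
        exact Complex.abs_im_le_norm s
    _ = _ := by ring

/-- By this symmetry a single good ordinate serves both horizontal sides. -/
lemma norm_riemannZeta_neg_im (x T : ℝ) :
    ‖riemannZeta (x + Complex.I * (-T : ℝ))‖ = ‖riemannZeta (x + Complex.I * T)‖ := by
  have : (x + Complex.I * (-T : ℝ) : ℂ) = (starRingEnd ℂ) (x + Complex.I * T) := by simp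
  rw [this, riemannZeta_conj, RCLike.norm_conj]

lemma continuousOn_norm_riemannZeta_horizontal (c : ℝ) {T : ℝ} (hT : T ≠ 0) :
    ContinuousOn (fun x : ℝ => ‖riemannZeta (x + Complex.I * T)‖) (uIcc (1 / 2 : ℝ) c) := by
  intro x _
  refine ContinuousAt.continuousWithinAt (ContinuousAt.norm ?_)
  refine ContinuousAt.comp (f := fun x : ℝ => (x + Complex.I * T : ℂ)) (g := riemannZeta)
    (differentiableAt_riemannZeta ?_).continuousAt (by fun_prop)
  intro h
  have := congrArg Complex.im h
  simp [hT] at this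

/-- Moving the line of integration from `Re s = 1 + 1 / log N` to `Re s = 1 / 2`. -/
theorem norm_integral_perronFun_sub_le {N : ℕ} (hN : 3 ≤ N) {T : ℝ} (hT : 0 < T) :
    ‖(2 * Real.pi : ℂ)⁻¹ * ((∫ t in (-T)..T, perronFun N ((1 + 1 / Real.log N : ℝ) + Complex.I * t))
        - ∫ t in (-T)..T, perronFun N (1 / 2 + Complex.I * t)) - N ^ 2 * mertensSum 1 N ^ 2‖
      ≤ 36 * Real.log N ^ 2 * N ^ 2 / T
        * ∫ x in (1 / 2 : ℝ)..(1 + 1 / Real.log N), ‖riemannZeta (x + Complex.I * T)‖ := by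
  have hN3 : (3 : ℝ) ≤ N := by exact_mod_cast hN
  have hℓ : 0 < Real.log N := Real.log_pos (by linarith)
  set c : ℝ := 1 + 1 / Real.log N with hc
  have hc1 : 1 < c := by rw [hc]; linarith [one_div_pos.2 hℓ]
  have hle : (1 / 2 : ℝ) ≤ c := by linarith
  have key := integral_perronFun_sub (show N ≠ 0 by omega) hc1 hT
  set Z := ∫ x in (1 / 2 : ℝ)..c, ‖riemannZeta (x + Complex.I * T)‖ with hZ
  set K := 36 * Real.log N ^ 2 * N ^ 2 / T with hK
  have hK0 : 0 ≤ K := by positivity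
  have hZ0 : 0 ≤ Z := intervalIntegral.integral_nonneg hle fun _ _ => norm_nonneg _
  have hi : IntervalIntegrable (fun x : ℝ => ‖riemannZeta (x + Complex.I * T)‖) volume (1 / 2) c :=
    (continuousOn_norm_riemannZeta_horizontal c hT.ne').intervalIntegrable
  have hside : ∀ Y : ℝ, |Y| = T → (∀ x : ℝ, ‖riemannZeta (x + Complex.I * Y)‖
      = ‖riemannZeta (x + Complex.I * T)‖) →
      ‖∫ x in (1 / 2 : ℝ)..c, perronFun N (x + Complex.I * Y)‖ ≤ K * Z := by
    intro Y hY hsymm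
    rw [hZ, ← intervalIntegral.integral_const_mul]
    refine intervalIntegral.norm_integral_le_of_norm_le hle (ae_of_all _ fun x hx => ?_)
      (hi.const_mul _)
    have hY0 : Y ≠ 0 := by rintro rfl; simp at hY; linarith
    have h := norm_perronFun_le hN (s := x + Complex.I * Y) (by simpa [hc] using hx.2) (by simpa using hY0)
    have him : (x + Complex.I * Y : ℂ).im = Y := by simp
    rwa [him, hY, hsymm] at h
  have h1 := hside T (abs_of_pos hT) fun _ => rfl
  have h2 := hside (-T) (by rw [abs_neg, abs_of_pos hT]) fun x => norm_riemannZeta_neg_im x T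
  set A : ℂ := (∫ t in (-T)..T, perronFun N (c + Complex.I * t))
        - ∫ t in (-T)..T, perronFun N (1 / 2 + Complex.I * t) with hA
  have hpi : (Real.pi : ℂ) ≠ 0 := by exact_mod_cast Real.pi_ne_zero
  have e : (2 * Real.pi : ℂ)⁻¹ * A - N ^ 2 * mertensSum 1 N ^ 2
      = (2 * Real.pi * Complex.I : ℂ)⁻¹ * ((∫ x in (1 / 2 : ℝ)..c, perronFun N (x + Complex.I * T))
        - ∫ x in (1 / 2 : ℝ)..c, perronFun N (x + Complex.I * (-T : ℝ))) := by
    rw [← key]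
    have := Complex.I_ne_zero
    field_simp
  rw [e, norm_mul, norm_inv, norm_mul, norm_mul, Complex.norm_I, Complex.norm_real,
    Real.norm_of_nonneg Real.pi_pos.le, Complex.norm_ofNat, mul_one]
  have h3 := (norm_sub_le (∫ x in (1 / 2 : ℝ)..c, perronFun N (x + Complex.I * T))
    (∫ x in (1 / 2 : ℝ)..c, perronFun N (x + Complex.I * (-T : ℝ)))).trans (add_le_add h1 h2)
  rw [inv_mul_le_iff₀ (by positivity)]
  refine h3.trans ?_
  nlinarith [Real.pi_gt_three, mul_nonneg hK0 hZ0]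

lemma integrable_riemannZeta_rect {a b c d : ℝ} (hc : 0 < c) :
    Integrable (fun p : ℝ × ℝ => ‖riemannZeta (p.2 + Complex.I * p.1)‖)
      ((volume.restrict (Ioc c d)).prod (volume.restrict (Ioc a b))) := by
  rw [Measure.prod_restrict]
  have hcont : ContinuousOn (fun p : ℝ × ℝ => ‖riemannZeta (p.2 + Complex.I * p.1)‖)
      (Icc c d ×ˢ Icc a b) := by
    intro p hp
    refine ContinuousAt.continuousWithinAt (ContinuousAt.norm ?_)
    refine ContinuousAt.comp (f := fun p : ℝ × ℝ => (p.2 + Complex.I * p.1 : ℂ)) (g := riemannZeta)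
      (differentiableAt_riemannZeta ?_).continuousAt (by fun_prop)
    intro h
    have h' := congrArg Complex.im h
    simp at h'
    have := hp.1.1
    linarith
  exact (hcont.integrableOn_compact (isCompact_Icc.prod isCompact_Icc)).mono_set
    (prod_mono Ioc_subset_Icc_self Ioc_subset_Icc_self)

/-- Some horizontal segment with ordinate in `[T₀, 2 T₀]` has a small integral of `|ζ|`. -/
theorem exists_integral_norm_riemannZeta_le :
    ∃ K : ℝ, 0 < K ∧ ∀ T₀ c : ℝ, 1 ≤ T₀ → c ∈ Icc (1 / 2 : ℝ) 2 → ∃ T ∈ Icc T₀ (2 * T₀),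
      ∫ x in (1 / 2 : ℝ)..c, ‖riemannZeta (x + Complex.I * T)‖ ≤ K * (1 + Real.log T₀) := by
  obtain ⟨C, hC, hmean⟩ := exists_riemannZeta_mean_square_le
  refine ⟨2 * (1 + C), by positivity, fun T₀ c hT₀ hc => ?_⟩
  -- Averaging: if every `T` failed, the double integral of `|ζ|` would be at least `2(1+C) R T₀`.
  -- Fubini, `|ζ| ≤ 1 + |ζ|²` and the mean square bound it by `(1+C) R T₀ (c - 1/2)`, and `c - 1/2 ≤
  -- 3/2`.
  by_contra! hcon
  have hT0 : 0 < T₀ := by linarith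
  have hle : T₀ ≤ 2 * T₀ := by linarith
  have hlog : 0 ≤ Real.log T₀ := Real.log_nonneg hT₀
  set R := 1 + Real.log T₀ with hR
  have hR1 : 1 ≤ R := by rw [hR]; linarith
  have hint := integrable_riemannZeta_rect (a := 1 / 2) (b := c) (d := 2 * T₀) hT0
  have hlow : 2 * (1 + C) * R * T₀ ≤ ∫ T in Ioc T₀ (2 * T₀), ∫ x in Ioc (1 / 2 : ℝ) c,
      ‖riemannZeta (x + Complex.I * T)‖ := by
    have h1 : ∫ _ in Ioc T₀ (2 * T₀), 2 * (1 + C) * R = 2 * (1 + C) * R * T₀ := by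
      rw [setIntegral_const, Measure.real, Real.volume_Ioc,
        ENNReal.toReal_ofReal (by linarith), smul_eq_mul]
      ring
    rw [← h1]
    refine setIntegral_mono_on (integrableOn_const (by simp)) hint.integral_prod_left
      measurableSet_Ioc fun T hT => ?_
    have := hcon T (Ioc_subset_Icc_self hT)
    rw [intervalIntegral.integral_of_le hc.1] at this
    exact this.le
  rw [integral_integral_swap (f := fun T x : ℝ => ‖riemannZeta (x + Complex.I * T)‖) hint] at hlow
  have hup : ∀ x ∈ Ioc (1 / 2 : ℝ) c, ∫ T in Ioc T₀ (2 * T₀), ‖riemannZeta (x + Complex.I * T)‖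
      ≤ (1 + C) * R * T₀ := by
    intro x hx
    have hcont : ContinuousOn (fun t : ℝ => ‖riemannZeta (x + Complex.I * t)‖) (Icc T₀ (2 * T₀)) := by
      intro t ht
      refine ContinuousAt.continuousWithinAt (ContinuousAt.norm ?_)
      refine ContinuousAt.comp (f := fun t : ℝ => (x + Complex.I * t : ℂ)) (g := riemannZeta)
        (differentiableAt_riemannZeta ?_).continuousAt (by fun_prop)
      intro h
      have h' := congrArg Complex.im h
      simp at h'
      linarith [ht.1]
    have hm := hmean T₀ hT₀ x ⟨hx.1.le, hx.2.trans hc.2⟩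
    rw [← uIcc_of_le hle] at hcont
    have hsq : IntervalIntegrable (fun t : ℝ => ‖riemannZeta (x + Complex.I * t)‖ ^ 2) volume
        T₀ (2 * T₀) := (hcont.pow 2).intervalIntegrable
    rw [← intervalIntegral.integral_of_le hle]
    calc _ ≤ ∫ t in T₀..2 * T₀, (1 + ‖riemannZeta (x + Complex.I * t)‖ ^ 2) := by
          refine intervalIntegral.integral_mono_on hle hcont.intervalIntegrable
            (intervalIntegrable_const.add hsq) fun t _ => ?_
          nlinarith [sq_nonneg (‖riemannZeta (x + Complex.I * t)‖ - 1)]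
      _ = T₀ + ∫ t in T₀..2 * T₀, ‖riemannZeta (x + Complex.I * t)‖ ^ 2 := by
          rw [intervalIntegral.integral_add intervalIntegrable_const hsq,
            intervalIntegral.integral_const, smul_eq_mul]
          ring
      _ ≤ T₀ * R + C * (T₀ * R) := add_le_add (le_mul_of_one_le_right hT0.le hR1) hm
      _ = _ := by ring
  have hup2 : ∫ x in Ioc (1 / 2 : ℝ) c, ∫ T in Ioc T₀ (2 * T₀), ‖riemannZeta (x + Complex.I * T)‖
      ≤ (1 + C) * R * T₀ * (c - 1 / 2) := by
    have h1 : ∫ _ in Ioc (1 / 2 : ℝ) c, (1 + C) * R * T₀ = (1 + C) * R * T₀ * (c - 1 / 2) := by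
      rw [setIntegral_const, Measure.real, Real.volume_Ioc,
        ENNReal.toReal_ofReal (by linarith [hc.1]), smul_eq_mul]
      ring
    rw [← h1]
    exact setIntegral_mono_on hint.integral_prod_right (integrableOn_const (by simp))
      measurableSet_Ioc hup
  have hpos : 0 < (1 + C) * R * T₀ := by positivity
  have := hlow.trans hup2
  nlinarith [hc.2]

/-! ### Assembling the estimate -/

lemma moebiusNorm_pos {N : ℕ} (hN : 0 < N) : 0 < moebiusNorm N := by
  rw [moebiusNorm, norm_pos_iff]
  intro h
  have h1 := congrArg (fun v : EuclideanSpace ℝ (Fin N) => v ⟨0, hN⟩) h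
  simp [moebiusVec] at h1

lemma truncZeta_one_pos {N : ℕ} (hN : 0 < N) : 0 < truncZeta N 1 := by
  refine Finset.sum_pos (fun m hm => ?_) ⟨1, by simp; omega⟩
  have : (0 : ℝ) < m := by exact_mod_cast (Finset.mem_Icc.1 hm).1
  positivity

/-- With `s = 1/2 + it` one has `N^{2s} = N · N^{2it}` and `π + 2πit = 2πs`; the normalizations by
`ζ₁` and `‖m‖` cancel, being nonzero. -/
lemma integrand_eq_perronFun {N : ℕ} (hN : 0 < N) (t : ℝ) :
    ((moebiusNorm N ^ 2 / (N : ℝ) : ℝ) : ℂ) * integrand N t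
      = ((N : ℂ) ^ 2)⁻¹ * ((2 * Real.pi : ℂ)⁻¹ * perronFun N (1 / 2 + Complex.I * t)) := by
  have hm : (moebiusNorm N : ℂ) ≠ 0 := by exact_mod_cast (moebiusNorm_pos hN).ne'
  have hz := truncZeta_one_pos hN
  have hzc : (truncZeta N 1 : ℂ) ≠ 0 := by exact_mod_cast hz.ne'
  have hs : ((√(truncZeta N 1) : ℝ) : ℂ) ^ 2 = truncZeta N 1 := by
    exact_mod_cast Real.sq_sqrt hz.le
  have hNc : (N : ℂ) ≠ 0 := by exact_mod_cast hN.ne'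
  have hpi : (Real.pi : ℂ) ≠ 0 := by exact_mod_cast Real.pi_ne_zero
  have hline : (1 / 2 + Complex.I * t : ℂ) ≠ 0 := by
    intro h
    have := congrArg Complex.re h
    simp at this
  have hden : (Real.pi + 2 * Real.pi * Complex.I * t : ℂ)
      = 2 * Real.pi * (1 / 2 + Complex.I * t) := by ring
  have hpow : (N : ℂ) ^ (2 * (1 / 2 + Complex.I * t : ℂ)) = N * (N : ℂ) ^ (2 * Complex.I * t) := by
    rw [show (2 * (1 / 2 + Complex.I * t) : ℂ) = 1 + 2 * Complex.I * t by ring,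
      Complex.cpow_add _ _ hNc, Complex.cpow_one]
  rw [integrand, perronFun, hden, hpow, div_pow, mul_pow, hs]
  push_cast
  field_simp

end MertensForm

open MertensForm in
theorem mainTheorem7 :
    ∃ C : ℝ, 0 < C ∧
      ∀ (N : ℕ) (T₀ : ℝ), 3 ≤ T₀ → T₀ ≤ (N : ℝ) →
        ∃ T : ℝ, T ∈ Set.Icc T₀ (2 * T₀) ∧
          ‖((MertensForm.quadForm N / (N : ℝ) ^ 2 : ℝ) : ℂ)
              - ((MertensForm.mertensSum 1 (N : ℝ)) ^ 2
                + ((MertensForm.moebiusNorm N ^ 2 / (N : ℝ) : ℝ) : ℂ)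
                  * ∫ t in (-T)..T, MertensForm.integrand N t)‖
            ≤ C * (T₀⁻¹ * Real.log (N : ℝ) ^ 3) := by
  obtain ⟨K, hK, hZ⟩ := exists_integral_norm_riemannZeta_le
  -- `17280` is the Perron error, and `72 K = 36 · 2K` comes from the horizontal sides with `1 + log
  -- T₀ ≤ 2 log N`.
  refine ⟨17280 + 72 * K, by positivity, fun N T₀ hT₀ hTN => ?_⟩
  have hN3 : (3 : ℝ) ≤ N := hT₀.trans hTN
  have hN : 3 ≤ N := by exact_mod_cast hN3
  have hNpos : (0 : ℝ) < N := by linarith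
  have hℓ : 1 ≤ Real.log N := by
    rw [Real.le_log_iff_exp_le hNpos]
    linarith [Real.exp_one_lt_d9]
  set ℓ := Real.log N with hℓdef
  have hinv : 0 < 1 / ℓ := by positivity
  have hinv1 : 1 / ℓ ≤ 1 := by rw [div_le_one (by linarith)]; exact hℓ
  obtain ⟨T, hT, hZT⟩ := hZ T₀ (1 + 1 / ℓ) (by linarith) ⟨by linarith, by linarith⟩
  refine ⟨T, hT, ?_⟩
  have hT0 : 0 < T := by linarith [hT.1]
  -- `T ≤ 2T₀ ≤ 2N` is the range in which the near coefficients are under control.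
  have hP := norm_quadForm_sub_integral_le hN hT0 (by linarith [hT.2])
  have hQ := norm_integral_perronFun_sub_le hN hT0
  rw [← hℓdef] at hP hQ
  have hlogT : 1 + Real.log T₀ ≤ 2 * ℓ := by
    have : Real.log T₀ ≤ ℓ := Real.log_le_log (by linarith) hTN
    linarith
  have hNc : (N : ℂ) ≠ 0 := by exact_mod_cast hNpos.ne'
  set A : ℂ := ∫ t in (-T)..T, perronFun N ((1 + 1 / ℓ : ℝ) + Complex.I * t) with hA
  set B : ℂ := ∫ t in (-T)..T, perronFun N (1 / 2 + Complex.I * t) with hB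
  have hI : ((moebiusNorm N ^ 2 / (N : ℝ) : ℝ) : ℂ) * ∫ t in (-T)..T, integrand N t
      = ((N : ℂ) ^ 2)⁻¹ * ((2 * Real.pi : ℂ)⁻¹ * B) := by
    rw [hB, ← intervalIntegral.integral_const_mul, ← intervalIntegral.integral_const_mul,
      ← intervalIntegral.integral_const_mul]
    exact intervalIntegral.integral_congr fun t _ => integrand_eq_perronFun (by omega) t
  have hsplit : ((quadForm N / (N : ℝ) ^ 2 : ℝ) : ℂ) - (mertensSum 1 N ^ 2
        + ((moebiusNorm N ^ 2 / (N : ℝ) : ℝ) : ℂ) * ∫ t in (-T)..T, integrand N t)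
      = ((N : ℂ) ^ 2)⁻¹ * (((quadForm N : ℂ) - (2 * Real.pi : ℂ)⁻¹ * A)
        + ((2 * Real.pi : ℂ)⁻¹ * (A - B) - N ^ 2 * mertensSum 1 N ^ 2)) := by
    rw [hI]
    push_cast
    field_simp
    ring
  rw [hsplit, norm_mul, norm_inv, norm_pow, Complex.norm_natCast]
  have hZ2 : 36 * ℓ ^ 2 * N ^ 2 / T * ∫ x in (1 / 2 : ℝ)..(1 + 1 / ℓ),
      ‖riemannZeta (x + Complex.I * T)‖ ≤ 36 * ℓ ^ 2 * N ^ 2 / T * (K * (2 * ℓ)) := by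
    gcongr
    exact hZT.trans (by gcongr)
  have hsum := (norm_add_le ((quadForm N : ℂ) - (2 * Real.pi : ℂ)⁻¹ * A)
    ((2 * Real.pi : ℂ)⁻¹ * (A - B) - N ^ 2 * mertensSum 1 N ^ 2)).trans
    (add_le_add hP (hQ.trans hZ2))
  have hTinv : T⁻¹ ≤ T₀⁻¹ := inv_anti₀ (by linarith) hT.1
  calc ((N : ℝ) ^ 2)⁻¹ * _ ≤ ((N : ℝ) ^ 2)⁻¹ *
        (17280 * ℓ ^ 3 * (N ^ 2 / T) + 36 * ℓ ^ 2 * N ^ 2 / T * (K * (2 * ℓ))) := by gcongr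
    _ = (17280 + 72 * K) * (T⁻¹ * ℓ ^ 3) := by field_simp; ring
    _ ≤ _ := by gcongr
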